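/- **Theorem (explicit unshifted QR).** *Floating point model.* An arithmetic with unit roundoff $u$ is any collection of functions realizing $+,-,\times,/$ on complex numbers, addition of reals, the squared modulus and the real square root, each returning the exact result times a factor $1+\delta$ with $|\delta|\le u$ ($y\ne 0$ for $x/y$, $x\ge 0$ for $\sqrt x$). Negation, conjugation and comparisons are exact. *Algorithm.* Let $A\in\mathbb{C}^{n\times n}$ be Hermitian and $p,q\in\mathbb{C}^n$ be such that $A+pq^*$ is lower Hessenberg. Write $d_i=a_{i,i}$, $\beta_i=a_{i,i+1}$, and write $\overline{x}$ for the conjugate of $x$. Let $\epsilon>0$. For $i=1,\dots,n-1$: while the computed value of $|\beta_i+p_i\overline{q_{i+1}}|$ is $\ge\epsilon$, perform one QR iteration on the indices $i,\dots,n$. At the end return $\lambda_j=d_j+p_j\overline{q_j}$, $j=1,\dots,n$. One QR iteration on the indices $i,\dots,n$ consists of the following two loops. (1) Elimination. Set $\gamma\leftarrow\overline\beta$, $\tilde q\leftarrow q$. For $k=n,n-1,\dots,i+1$: let $x_1=\beta_{k-1}+p_{k-1}\overline{q_k}$, $x_2=d_k+p_k\overline{q_k}$, and $Q_k=\begin{pmatrix}c&-s\\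 \overline s&\overline c\end{pmatrix}$ with $c=x_2/\sqrt{|x_1|^2+|x_2|^2}$, $s=x_1/\sqrt{|x_1|^2+|x_2|^2}$ (and $c=1$, $s=0$ if $x_1=x_2=0$); if $k\ne i+1$, set $\gamma_{k-2}\leftarrow\bigl(Q_k(\gamma_{k-2},-\tilde q_k\overline{p_{k-2}})^T\bigr)_1$; replace the pairs $(d_{k-1},\gamma_{k-1})^T$, $(\beta_{k-1},d_k)^T$, $(p_{k-1},p_k)^T$, in this order, by their products with $Q_k$; if then $|p_{k-1}\overline{q_k}|^2+|p_k\overline{q_k}|^2>|\beta_{k-1}|^2+|d_k|^2$, set $p_{k-1}\leftarrow-\beta_{k-1}/\overline{q_k}$; replace $(\tilde q_{k-1},\tilde q_k)^T$ by its product with $Q_k$. (2) Rotation back. For $k=n,n-1,\dots,i+1$: set $(d_{k-1},\beta_{k-1})^T\leftarrow\overline{Q_k}\,(d_{k-1},-p_{k-1}\overline{q_k})^T$, then $d_k\leftarrow\bigl(\overline{Q_k}(\gamma_{k-1},d_k)^T\bigr)_2$, then $(q_{k-1},q_k)^T\leftarrow Q_k(q_{k-1},q_k)^T$. *Claim.*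 There are absolute constants $C>0$ and $a\in\mathbb{N}$ such that the following holds for all $n$, $u$, $A$, $p$, $q$, $\epsilon$ as above, every arithmetic with unit roundoff $u$, and every $\kappa\ge 0$ with $\epsilon\le\kappa\|A\|u$. Suppose that the algorithm, with every operation carried out in this arithmetic, terminates after $m$ QR iterations in total with the outputs $\hat\lambda_1,\dots,\hat\lambda_n$, and that $C n^a(m+1)^2(1+\kappa)\,u\le 1$. Then there exist $\delta A\in\mathbb{C}^{n\times n}$ and $\delta p,\delta q\in\mathbb{C}^n$ such that $\hat\lambda_1,\dots,\hat\lambda_n$ are, with multiplicity, exactly the eigenvalues of $$(A+\delta A)+(p+\delta p)(q+\delta q)^*,$$ and $$\|\delta A\|\le C n^a(m+1)^2(1+\kappa)\,\|A\|\,u,\qquad \|\delta p\|\le C n^a(m+1)\,\|p\|\,u,\qquad \|\delta q\|\le C n^a(m+1)\,\|q\|\,u .$$ Here $\|\cdot\|$ is the Frobenius norm of matrices and the Euclidean norm of vectors. In other words, the algorithm is componentwise backward stable. -/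

import Mathlib

open scoped ComplexConjugate Matrix.Norms.Frobenius

noncomputable section

/-- Floating point arithmetic with unit roundoff `u`: the result of each operation is the exact
result times `1 + δ` with `|δ| ≤ u`.  Complex numbers are the scalars; `addR`, `absSq` and `sqrt`
are the addition of reals, the squared modulus and the real square root.  Negation, conjugation and
comparison are exact. -/
structure FloatArith (u : ℝ) where
  add : ℂ → ℂ → ℂ
  sub : ℂ → ℂ → ℂ
  mul : ℂ → ℂ → ℂ
  div : ℂ → ℂ → ℂ
  addR : ℝ → ℝ → ℝ
  absSq : ℂ → ℝ
  sqrt : ℝ → ℝ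
  add_err : ∀ x y, ∃ δ : ℂ, ‖δ‖ ≤ u ∧ add x y = (x + y) * (1 + δ)
  sub_err : ∀ x y, ∃ δ : ℂ, ‖δ‖ ≤ u ∧ sub x y = (x - y) * (1 + δ)
  mul_err : ∀ x y, ∃ δ : ℂ, ‖δ‖ ≤ u ∧ mul x y = (x * y) * (1 + δ)
  div_err : ∀ x y, y ≠ 0 → ∃ δ : ℂ, ‖δ‖ ≤ u ∧ div x y = (x / y) * (1 + δ)
  addR_err : ∀ x y, ∃ δ : ℝ, |δ| ≤ u ∧ addR x y = (x + y) * (1 + δ)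
  absSq_err : ∀ x, ∃ δ : ℝ, |δ| ≤ u ∧ absSq x = ‖x‖ ^ 2 * (1 + δ)
  sqrt_err : ∀ x, 0 ≤ x → ∃ δ : ℝ, |δ| ≤ u ∧ sqrt x = Real.sqrt x * (1 + δ)

namespace StructuredQR

variable {u : ℝ}

/-- The pair `(c, s)` of the computed rotation `Q = [[c, -s], [conj s, conj c]]` that eliminates
the first entry of `(x₁, x₂)ᵀ`. -/
def mkRot (F : FloatArith u) (x₁ x₂ : ℂ) : ℂ × ℂ :=
  open Classical in
  if x₁ = 0 ∧ x₂ = 0 then (1, 0)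
  else
    let r : ℂ := (F.sqrt (F.addR (F.absSq x₁) (F.absSq x₂)) : ℝ)
    (F.div x₂ r, F.div x₁ r)

/-- The computed first entry of `Q (a, b)ᵀ`, where `Q = [[c, -s], [conj s, conj c]]` and
`Qcs = (c, s)`. -/
def rotFst (F : FloatArith u) (Qcs : ℂ × ℂ) (a b : ℂ) : ℂ :=
  F.sub (F.mul Qcs.1 a) (F.mul Qcs.2 b)

/-- The computed second entry of `Q (a, b)ᵀ`. -/
def rotSnd (F : FloatArith u) (Qcs : ℂ × ℂ) (a b : ℂ) : ℂ :=
  F.add (F.mul (conj Qcs.2) a) (F.mul (conj Qcs.1) b)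

/-- The entrywise complex conjugate of the rotation `Q`. -/
def conjRot (Qcs : ℂ × ℂ) : ℂ × ℂ := (conj Qcs.1, conj Qcs.2)

/-- The generators of `A + p q*`: diagonal `d` and superdiagonal `β` of `A`, and `p`, `q`.  Vectors
are arrays indexed from `0`; for matrices of order `n` only the indices `< n` (for `β`, `< n - 1`)
matter. -/
structure Generators where
  d : ℕ → ℂ
  β : ℕ → ℂ
  p : ℕ → ℂ
  q : ℕ → ℂ

/-- The variables of the elimination of the superdiagonal: diagonal, subdiagonal, superdiagonal,
`p`, the rotated copy `qt` of `q`, and the rotations; `Q j` rotates the `(j, j+1)`-plane. -/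
structure ElimState where
  d : ℕ → ℂ
  γ : ℕ → ℂ
  β : ℕ → ℂ
  p : ℕ → ℂ
  qt : ℕ → ℂ
  Q : ℕ → ℂ × ℂ

/-- Elimination of the superdiagonal entry in position `(j, j+1)`, for the submatrix whose first
row and column have index `i`. -/
def elimStep (F : FloatArith u) (q : ℕ → ℂ) (i j : ℕ) (s : ElimState) : ElimState :=
  open Classical in
  let qc : ℂ := conj (q (j + 1))
  let R : ℂ × ℂ := mkRot F (F.add (s.β j) (F.mul (s.p j) qc))
    (F.add (s.d (j + 1)) (F.mul (s.p (j + 1)) qc))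
  -- rotate the subdiagonal and the sub-subdiagonal
  let γ : ℕ → ℂ :=
    if j = i then s.γ
    else Function.update s.γ (j - 1)
      (rotFst F R (s.γ (j - 1)) (-(F.mul (s.qt (j + 1)) (conj (s.p (j - 1))))))
  -- rotate the superdiagonal and the diagonal
  let βj : ℂ := rotFst F R (s.β j) (s.d (j + 1))
  let dj1 : ℂ := rotSnd F R (s.β j) (s.d (j + 1))
  -- rotate `p`
  let pj : ℂ := rotFst F R (s.p j) (s.p (j + 1))
  let pj1 : ℂ := rotSnd F R (s.p j) (s.p (j + 1))
  -- correct `p`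
  let pj' : ℂ :=
    if F.addR (F.absSq (F.mul pj qc)) (F.absSq (F.mul pj1 qc)) >
        F.addR (F.absSq βj) (F.absSq dj1)
    then -(F.div βj qc) else pj
  { -- rotate the diagonal and the subdiagonal
    d := Function.update (Function.update s.d j (rotFst F R (s.d j) (γ j))) (j + 1) dj1
    γ := Function.update γ j (rotSnd F R (s.d j) (γ j))
    β := Function.update s.β j βj
    p := Function.update (Function.update s.p j pj') (j + 1) pj1
    -- rotate `qt`
    qt := Function.update (Function.update s.qt j (rotFst F R (s.qt j) (s.qt (j + 1)))) (j + 1)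
      (rotSnd F R (s.qt j) (s.qt (j + 1)))
    Q := Function.update s.Q j R }

/-- The steps `j = i + t - 1, …, i + 1, i` of the elimination, in this order. -/
def elimLoop (F : FloatArith u) (q : ℕ → ℂ) (i : ℕ) : ℕ → ElimState → ElimState
  | 0, s => s
  | t + 1, s => elimLoop F q i t (elimStep F q i (i + t) s)

/-- The variables of the rotation back to Hessenberg form. -/
structure BackState where
  d : ℕ → ℂ
  β : ℕ → ℂ
  q : ℕ → ℂ

/-- Application of the rotation of the `(j, j+1)`-plane from the right. -/
def backStep (F : FloatArith u) (γ p : ℕ → ℂ) (Q : ℕ → ℂ × ℂ) (j : ℕ) (s : BackState) :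
    BackState :=
  let a : ℂ := -(F.mul (p j) (conj (s.q (j + 1))))
  { -- rotate the diagonal and the superdiagonal, and the subdiagonal and the diagonal
    d := Function.update (Function.update s.d j (rotFst F (conjRot (Q j)) (s.d j) a)) (j + 1)
      (rotSnd F (conjRot (Q j)) (γ j) (s.d (j + 1)))
    β := Function.update s.β j (rotSnd F (conjRot (Q j)) (s.d j) a)
    -- rotate `q`
    q := Function.update (Function.update s.q j (rotFst F (Q j) (s.q j) (s.q (j + 1)))) (j + 1)
      (rotSnd F (Q j) (s.q j) (s.q (j + 1))) }

/-- The steps `j = i + t - 1, …, i + 1, i` of the rotation back, in this order. -/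
def backLoop (F : FloatArith u) (γ p : ℕ → ℂ) (Q : ℕ → ℂ × ℂ) (i : ℕ) :
    ℕ → BackState → BackState
  | 0, s => s
  | t + 1, s => backLoop F γ p Q i t (backStep F γ p Q (i + t) s)

/-- One QR iteration on the trailing submatrix with the indices `i, …, n - 1`: elimination of the
superdiagonal, followed by the rotation back to Hessenberg form. -/
def sweep (F : FloatArith u) (n i : ℕ) (g : Generators) : Generators :=
  let e : ElimState := elimLoop F g.q i (n - 1 - i)
    { d := g.d, γ := fun j => conj (g.β j), β := g.β, p := g.p, qt := g.q, Q := fun _ => (1, 0) }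
  let b : BackState := backLoop F e.γ e.p e.Q i (n - 1 - i) { d := e.d, β := g.β, q := g.q }
  { d := b.d, β := b.β, p := e.p, q := b.q }

/-- The computed modulus of the superdiagonal entry of `A + p q*` in position `(i, i+1)`. -/
def superdiagAbs (F : FloatArith u) (i : ℕ) (g : Generators) : ℝ :=
  F.sqrt (F.absSq (F.add (g.β i) (F.mul (g.p i) (conj (g.q (i + 1))))))

/-- The while loop for the index `i`: `WhileLoop F n ε i g m g'` says that, started from `g`, the
loop terminates with `g'` after exactly `m` QR iterations. -/
inductive WhileLoop (F : FloatArith u) (n : ℕ) (ε : ℝ) (i : ℕ) :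
    Generators → ℕ → Generators → Prop
  | exit (g : Generators) : superdiagAbs F i g < ε → WhileLoop F n ε i g 0 g
  | step (g g' : Generators) (m : ℕ) : ε ≤ superdiagAbs F i g →
      WhileLoop F n ε i (sweep F n i g) m g' → WhileLoop F n ε i g (m + 1) g'

/-- The for loop over the indices `i, i + 1, …, n - 2`: `ForLoop F n ε i g m g'` says that, started
from `g`, it terminates with `g'` after exactly `m` QR iterations in total. -/
inductive ForLoop (F : FloatArith u) (n : ℕ) (ε : ℝ) :
    ℕ → Generators → ℕ → Generators → Prop
  | done (i : ℕ) (g : Generators) : n ≤ i + 1 → ForLoop F n ε i g 0 g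
  | next (i : ℕ) (g g' g'' : Generators) (m m' : ℕ) : i + 1 < n → WhileLoop F n ε i g m g' →
      ForLoop F n ε (i + 1) g' m' g'' → ForLoop F n ε i g (m + m') g''

/-- The generators of `A + p q*`. -/
def generators {n : ℕ} (A : Matrix (Fin n) (Fin n) ℂ) (p q : Fin n → ℂ) : Generators where
  d j := if h : j < n then A ⟨j, h⟩ ⟨j, h⟩ else 0
  β j := if h : j + 1 < n then A ⟨j, by omega⟩ ⟨j + 1, h⟩ else 0
  p j := if h : j < n then p ⟨j, h⟩ else 0
  q j := if h : j < n then q ⟨j, h⟩ else 0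

/-- The explicit unshifted QR algorithm with deflation, applied in floating point arithmetic with
tolerance `ε` to the generators of `A + p q*`, terminates after `m` QR iterations in total with the
computed eigenvalues `lam`. -/
def UnshiftedQR (F : FloatArith u) {n : ℕ} (ε : ℝ) (A : Matrix (Fin n) (Fin n) ℂ)
    (p q : Fin n → ℂ) (m : ℕ) (lam : Fin n → ℂ) : Prop :=
  ∃ g : Generators, ForLoop F n ε 0 (generators A p q) m g ∧
    ∀ j : Fin n, lam j = F.add (g.d j) (F.mul (g.p j) (conj (g.q j)))

/-- All entries above the superdiagonal vanish. -/
def IsLowerHessenberg {n : ℕ} (M : Matrix (Fin n) (Fin n) ℂ) : Prop :=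
  ∀ i j : Fin n, (i : ℕ) + 1 < (j : ℕ) → M i j = 0

/-- The Euclidean norm of a vector. -/
def vnorm {n : ℕ} (v : Fin n → ℂ) : ℝ := ‖WithLp.toLp 2 v‖

end StructuredQR

end

/-! The Hessenberg condition gives `a_{ab} = -p_a conj(q_b)` above the superdiagonal. With Hermitian
symmetry, `d`, `β`, `p`, `q` therefore describe all of `A` (`genMatrix`). A computed QR iteration is
compared with the exact similarity by one unitary matrix `U` that acts on `A`, `p` and `q` at once.
The point is to charge the errors in `A` to `‖A‖` alone and those in `p`, `q` to `‖p‖`, `‖q‖` alone,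
however large `‖p‖ ‖q‖` is.

In the elimination, the step on rows `j`, `j + 1` rotates every column of the described matrix up to
an error `O(u)` relative to the two entries involved (`elimStep_spec`). Most columns follow from
standard rounding bounds: an error in `p` or in the rotated `q` is an equal relative error in the
entries that it generates. The delicate column is `j + 1`. There `β_j` stops being stored and is
henceforth represented by `-p_j conj(q_{j+1})`. The two agree up to a residual `O(u)(B + P|q|)`,
where `B` and `P` are the sizes of the rotated pairs of `A` and of `p`. If `P|q| ≲ B`, the residual
is harmless for `A`. Otherwise the correction redefines `p_j`, which moves it by `O(u)P` only and
makes the entry of `A` accurate (`corrected_bounds`). This dichotomy is the heart of the proof.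

The rotation back treats the columns in the same way (`backStep_spec`), and at most `2n` rotations
give a relative error `η = O(nu)` per iteration (`sweep_spec`). Only the upper triangle is computed;
the lower one is its conjugate. Since computed diagonal entries need not be real, the described
matrix is Hermitian only up to a defect `s`. Completion by conjugation adds `s` to the error and
increases `s` by `O(η‖A‖)` (`sub_conjTranspose_completion`). So `s` grows linearly and the error in
`A` quadratically in the number of iterations, whence `(m + 1)²`; the errors in `p` and `q` never
meet the defect and stay linear.

A deflation alters two mirror entries by `O(ε + u‖A‖)`. At the end `A + p q*` is lower triangular,
the rounding of `d_j + p_j conj(q_j)` is absorbed into `d_j` and `p_j`, and everything is pulled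
back by the accumulated unitary (`Tracked.output`). -/

noncomputable section

open Matrix

namespace StructuredQR

/-! ### The Frobenius norm -/

section Frobenius

variable {n k : ℕ}

theorem frobenius_sq (M : Matrix (Fin n) (Fin k) ℂ) : ‖M‖ ^ 2 = ∑ a, ∑ b, ‖M a b‖ ^ 2 := by
  rw [frobenius_norm_def, ← Real.sqrt_eq_rpow, Real.sq_sqrt]
  · simp
  · positivity

theorem frobenius_sq_comm (M : Matrix (Fin n) (Fin k) ℂ) :
    ‖M‖ ^ 2 = ∑ b, ∑ a, ‖M a b‖ ^ 2 := by
  rw [frobenius_sq, Finset.sum_comm]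

theorem frobenius_sq_trace (M : Matrix (Fin n) (Fin k) ℂ) :
    ((‖M‖ ^ 2 : ℝ) : ℂ) = (Mᴴ * M).trace := by
  rw [frobenius_sq_comm]
  simp only [trace, diag, mul_apply, conjTranspose_apply]
  push_cast
  refine Finset.sum_congr rfl fun b _ => Finset.sum_congr rfl fun a _ => ?_
  exact (RCLike.conj_mul (M a b)).symm

theorem frobenius_norm_unitary_mul {U : Matrix (Fin n) (Fin n) ℂ}
    (hU : U ∈ unitaryGroup (Fin n) ℂ) (M : Matrix (Fin n) (Fin k) ℂ) : ‖U * M‖ = ‖M‖ := by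
  have h : ((‖U * M‖ ^ 2 : ℝ) : ℂ) = ((‖M‖ ^ 2 : ℝ) : ℂ) := by
    rw [frobenius_sq_trace, frobenius_sq_trace, conjTranspose_mul, Matrix.mul_assoc,
      ← Matrix.mul_assoc Uᴴ]
    have : Uᴴ * U = 1 := mem_unitaryGroup_iff'.1 hU
    rw [this, Matrix.one_mul]
  have h2 : ‖U * M‖ ^ 2 = ‖M‖ ^ 2 := by exact_mod_cast h
  exact (sq_eq_sq₀ (norm_nonneg _) (norm_nonneg _)).1 h2

theorem conjTranspose_mem_unitaryGroup {U : Matrix (Fin n) (Fin n) ℂ}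
    (hU : U ∈ unitaryGroup (Fin n) ℂ) : Uᴴ ∈ unitaryGroup (Fin n) ℂ := by
  rw [mem_unitaryGroup_iff, star_eq_conjTranspose, conjTranspose_conjTranspose]
  exact mem_unitaryGroup_iff'.1 hU

theorem frobenius_norm_mul_conjTranspose_unitary {U : Matrix (Fin n) (Fin n) ℂ}
    (hU : U ∈ unitaryGroup (Fin n) ℂ) (M : Matrix (Fin k) (Fin n) ℂ) : ‖M * Uᴴ‖ = ‖M‖ := by
  rw [← frobenius_norm_conjTranspose, conjTranspose_mul, conjTranspose_conjTranspose,
    frobenius_norm_unitary_mul hU, frobenius_norm_conjTranspose]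

theorem frobenius_norm_conj_unitary {U : Matrix (Fin n) (Fin n) ℂ}
    (hU : U ∈ unitaryGroup (Fin n) ℂ) (M : Matrix (Fin n) (Fin n) ℂ) : ‖U * M * Uᴴ‖ = ‖M‖ := by
  rw [frobenius_norm_mul_conjTranspose_unitary hU, frobenius_norm_unitary_mul hU]

theorem frobenius_norm_mono {M N : Matrix (Fin n) (Fin k) ℂ} (h : ∀ a b, ‖M a b‖ ≤ ‖N a b‖) :
    ‖M‖ ≤ ‖N‖ := by
  refine (sq_le_sq₀ (norm_nonneg _) (norm_nonneg _)).1 ?_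
  rw [frobenius_sq, frobenius_sq]
  gcongr with a _ b _
  exact h a b

/-- The matrix of the moduli of the entries. -/
def absMat (M : Matrix (Fin n) (Fin k) ℂ) : Matrix (Fin n) (Fin k) ℂ := M.map fun x => (‖x‖ : ℂ)

theorem norm_absMat (M : Matrix (Fin n) (Fin k) ℂ) : ‖absMat M‖ = ‖M‖ :=
  le_antisymm (frobenius_norm_mono fun a b => by simp [absMat])
    (frobenius_norm_mono fun a b => by simp [absMat])

/-- Passing to the matrices of moduli turns the entrywise bound into the triangle inequality. -/
theorem frobenius_norm_le_of_le_add {M N P Q : Matrix (Fin n) (Fin k) ℂ}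
    (h : ∀ a b, ‖M a b‖ ≤ ‖N a b‖ + ‖P a b‖ + ‖Q a b‖) : ‖M‖ ≤ ‖N‖ + ‖P‖ + ‖Q‖ := by
  rw [← norm_absMat N, ← norm_absMat P, ← norm_absMat Q]
  refine le_trans (frobenius_norm_mono fun a b => ?_) norm_add₃_le
  refine (h a b).trans (le_of_eq ?_)
  simp only [absMat, Matrix.add_apply, map_apply]
  rw [← Complex.ofReal_add, ← Complex.ofReal_add, Complex.norm_real,
    Real.norm_of_nonneg (by positivity)]

theorem norm_apply_le_frobenius (M : Matrix (Fin n) (Fin k) ℂ) (a : Fin n) (b : Fin k) :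
    ‖M a b‖ ≤ ‖M‖ := by
  refine (sq_le_sq₀ (norm_nonneg _) (norm_nonneg _)).1 ?_
  rw [frobenius_sq]
  calc ‖M a b‖ ^ 2 ≤ ∑ b, ‖M a b‖ ^ 2 :=
        Finset.single_le_sum (f := fun b => ‖M a b‖ ^ 2) (fun _ _ => by positivity)
          (Finset.mem_univ b)
    _ ≤ _ := Finset.single_le_sum (f := fun a => ∑ b, ‖M a b‖ ^ 2) (fun _ _ => by positivity)
          (Finset.mem_univ a)

theorem frobenius_norm_single (a : Fin n) (b : Fin k) (x : ℂ) : ‖Matrix.single a b x‖ = ‖x‖ := by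
  refine (sq_eq_sq₀ (norm_nonneg _) (norm_nonneg _)).1 ?_
  rw [frobenius_sq, Finset.sum_eq_single a, Finset.sum_eq_single b]
  · simp
  · intro c _ hc; simp [hc.symm]
  · simp
  · intro c _ hc; simp [hc.symm]
  · simp

end Frobenius

/-! ### Plane rotations -/

/-- The leading `n × k` block of a doubly infinite array. -/
def trunc (n k : ℕ) (M : ℕ → ℕ → ℂ) : Matrix (Fin n) (Fin k) ℂ := fun a b => M a b

/-- The first `n` entries of an array, as a matrix with one column. -/
def col (n : ℕ) (x : ℕ → ℂ) : Matrix (Fin n) (Fin 1) ℂ := trunc n 1 fun a _ => x a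

/-- The pair `(c, s)` satisfies `|c|² + |s|² = 1`. -/
def IsRot (z : ℂ × ℂ) : Prop := z.1 * conj z.1 + z.2 * conj z.2 = 1

/-- First entry of the rotated pair. -/
def rfst (z : ℂ × ℂ) (x y : ℂ) : ℂ := z.1 * x - z.2 * y

/-- Second entry of the rotated pair. -/
def rsnd (z : ℂ × ℂ) (x y : ℂ) : ℂ := conj z.2 * x + conj z.1 * y

/-- Rotation of the entries `j`, `j + 1` of an array. -/
def rotArr (z : ℂ × ℂ) (j : ℕ) (x : ℕ → ℂ) : ℕ → ℂ := fun a =>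
  if a = j then rfst z (x j) (x (j + 1)) else if a = j + 1 then rsnd z (x j) (x (j + 1)) else x a

/-- The Givens rotation of the `(j, j+1)`-plane with cosine and sine `z`. -/
def givens (n j : ℕ) (z : ℂ × ℂ) : Matrix (Fin n) (Fin n) ℂ :=
  trunc n n fun a b => rotArr z j (fun c => if c = b then 1 else 0) a

theorem sum_fin_ite {n k : ℕ} (hk : k < n) (f : Fin n → ℂ) :
    (∑ c : Fin n, (if k = (c : ℕ) then 1 else 0) * f c) = f ⟨k, hk⟩ := by
  rw [Finset.sum_eq_single ⟨k, hk⟩]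
  · simp
  · intro c _ hc
    rw [if_neg, zero_mul]
    intro h
    exact hc (Fin.ext h.symm)
  · simp

theorem givens_mul_trunc {n k j : ℕ} (hj : j + 1 < n) (z : ℂ × ℂ) (M : ℕ → ℕ → ℂ) :
    givens n j z * trunc n k M = trunc n k fun a b => rotArr z j (fun a => M a b) a := by
  ext a b
  have e1 := sum_fin_ite (by omega : j < n) (fun c => trunc n k M c b)
  have e2 := sum_fin_ite hj (fun c => trunc n k M c b)
  have e3 := sum_fin_ite a.2 (fun c => trunc n k M c b)
  simp only [mul_apply, givens, trunc, rotArr] at *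
  split_ifs
  · simp only [rfst, sub_mul, mul_assoc, Finset.sum_sub_distrib, ← Finset.mul_sum, e1, e2]
  · simp only [rsnd, add_mul, mul_assoc, Finset.sum_add_distrib, ← Finset.mul_sum, e1, e2]
  · exact e3

theorem givens_mem_unitaryGroup {n j : ℕ} (hj : j + 1 < n) {z : ℂ × ℂ} (hz : IsRot z) :
    givens n j z ∈ unitaryGroup (Fin n) ℂ := by
  have hz' : z.1 * conj z.1 + z.2 * conj z.2 = 1 := hz
  have hz2 : conj z.1 * z.1 + conj z.2 * z.2 = 1 := by rw [← hz']; ring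
  rw [mem_unitaryGroup_iff, star_eq_conjTranspose]
  have : (givens n j z)ᴴ = trunc n n fun a b =>
      conj (rotArr z j (fun c => if c = a then 1 else 0) b) := rfl
  rw [this, givens_mul_trunc hj]
  ext ⟨a, ha⟩ ⟨b, hb⟩
  simp only [trunc, rotArr, rfst, rsnd, one_apply, Fin.mk.injEq]
  by_cases h1 : a = j
  · by_cases h2 : b = j
    · simp [h1, h2, hz']
    · by_cases h3 : b = j + 1
      · simp [h1, h3]; ring
      · simp [h1, h2, h3, Ne.symm h2]
  · by_cases h1' : a = j + 1
    · by_cases h2 : b = j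
      · simp [h1', h2]; ring
      · by_cases h3 : b = j + 1
        · simp [h1', h3]; rw [← hz2]; ring
        · simp [h1', h2, h3, Ne.symm h3]
    · by_cases h2 : b = j
      · simp [h1, h1', h2, Ne.symm h1, Ne.symm h1']
      · by_cases h3 : b = j + 1
        · simp [h1, h1', h3, Ne.symm h1, Ne.symm h1']
        · simp [h1, h1', h2, h3, eq_comm, apply_ite]

/-- The array `x'` is, up to errors of relative size `c`, the array `x` with the entries `j`,
`j + 1` rotated. -/
structure NearRot (c : ℝ) (n : ℕ) (z : ℂ × ℂ) (j : ℕ) (x x' : ℕ → ℂ) : Prop where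
  fst : ‖x' j - rfst z (x j) (x (j + 1))‖ ≤ c * (‖x j‖ + ‖x (j + 1)‖)
  snd : ‖x' (j + 1) - rsnd z (x j) (x (j + 1))‖ ≤ c * (‖x j‖ + ‖x (j + 1)‖)
  other : ∀ a < n, a ≠ j → a ≠ j + 1 → x' a = x a

theorem sum_pair_le {n j : ℕ} (hj : j + 1 < n) (f : ℕ → ℝ) (hf : ∀ a, 0 ≤ f a) :
    f j + f (j + 1) ≤ ∑ a : Fin n, f a := by
  have hne : (⟨j, by omega⟩ : Fin n) ≠ ⟨j + 1, hj⟩ := by simp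
  have := Finset.sum_pair (f := fun a : Fin n => f a) hne
  rw [← this]
  exact Finset.sum_le_sum_of_subset_of_nonneg (Finset.subset_univ _) fun _ _ _ => hf _

theorem sum_eq_pair {n j : ℕ} (hj : j + 1 < n) (f : ℕ → ℝ)
    (hf : ∀ a < n, a ≠ j → a ≠ j + 1 → f a = 0) :
    ∑ a : Fin n, f a = f j + f (j + 1) := by
  have hne : (⟨j, by omega⟩ : Fin n) ≠ ⟨j + 1, hj⟩ := by simp
  have := Finset.sum_pair (f := fun a : Fin n => f a) hne
  rw [← this]
  symm
  refine Finset.sum_subset (Finset.subset_univ _) fun a _ ha => hf a a.2 ?_ ?_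
  · rintro h; exact ha (by simp [Fin.ext_iff, h])
  · rintro h; exact ha (by simp [Fin.ext_iff, h])

/-- Only rows `j`, `j + 1` contribute. In each column both errors are at most `c(x + y)`, and `2(x +
y)² ≤ 4(x² + y²)` gives the factor 2. With `c = 200u` this is the `400u` of the loops. -/
theorem norm_sub_givens_mul_le {n k j : ℕ} (hj : j + 1 < n) {c : ℝ} (hc : 0 ≤ c) {z : ℂ × ℂ}
    {M M' : ℕ → ℕ → ℂ} (h : ∀ b < k, NearRot c n z j (fun a => M a b) (fun a => M' a b)) :
    ‖trunc n k M' - givens n j z * trunc n k M‖ ≤ 2 * c * ‖trunc n k M‖ := by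
  rw [givens_mul_trunc hj]
  refine (sq_le_sq₀ (norm_nonneg _) (by positivity)).1 ?_
  rw [mul_pow, frobenius_sq_comm, frobenius_sq_comm, Finset.mul_sum]
  refine Finset.sum_le_sum fun b _ => ?_
  have hb := h b b.2
  have e := sum_eq_pair hj (fun a => ‖M' a b - rotArr z j (fun a => M a b) a‖ ^ 2) (by
    intro a ha h1 h2
    simp [rotArr, h1, h2, hb.other a ha h1 h2])
  have l := sum_pair_le hj (fun a => ‖M a b‖ ^ 2) (fun _ => by positivity)
  have f1 := hb.fst
  have f2 := hb.snd
  simp only [Matrix.sub_apply, trunc]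
  rw [e]
  simp only [rotArr, if_true, Nat.succ_ne_self, if_false]
  refine le_trans ?_ (mul_le_mul_of_nonneg_left l (by positivity))
  have g1 := pow_le_pow_left₀ (norm_nonneg _) f1 2
  have g2 := pow_le_pow_left₀ (norm_nonneg _) f2 2
  have : (c * (‖M j b‖ + ‖M (j + 1) b‖)) ^ 2 ≤ c ^ 2 * (2 * (‖M j b‖ ^ 2 + ‖M (j + 1) b‖ ^ 2)) := by
    rw [mul_pow]
    gcongr
    nlinarith [sq_nonneg (‖M j b‖ - ‖M (j + 1) b‖)]
  calc _ ≤ _ := add_le_add (g1.trans this) (g2.trans this)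
    _ = _ := by ring

/-- The product of the Givens rotations of the planes `i`, …, `i + t - 1`. -/
def rotProd (n : ℕ) (z : ℕ → ℂ × ℂ) (i : ℕ) : ℕ → Matrix (Fin n) (Fin n) ℂ
  | 0 => 1
  | t + 1 => rotProd n z i t * givens n (i + t) (z (i + t))

theorem rotProd_mem_unitaryGroup {n i : ℕ} {z : ℕ → ℂ × ℂ} (hz : ∀ j, IsRot (z j)) :
    ∀ {t : ℕ}, i + t < n → rotProd n z i t ∈ unitaryGroup (Fin n) ℂ
  | 0, _ => one_mem _
  | t + 1, h => mul_mem (rotProd_mem_unitaryGroup hz (by omega))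
      (givens_mem_unitaryGroup (by omega) (hz _))

theorem givens_conj {n j : ℕ} (z : ℂ × ℂ) :
    givens n j (conj z.1, conj z.2) = (givens n j z)ᴴᵀ := by
  ext a b
  simp only [givens, trunc, rotArr, transpose_apply, conjTranspose_apply, rfst, rsnd]
  split_ifs <;> simp

/-- The transpose of the row version. Right multiplication by the adjoint rotates the entries of a
row with the conjugate pair. -/
theorem norm_sub_mul_givens_le {n j : ℕ} (hj : j + 1 < n) {c : ℝ} (hc : 0 ≤ c) {z : ℂ × ℂ}
    {M M' : ℕ → ℕ → ℂ} (h : ∀ a < n, NearRot c n (conj z.1, conj z.2) j (M a) (M' a)) :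
    ‖trunc n n M' - trunc n n M * (givens n j z)ᴴ‖ ≤ 2 * c * ‖trunc n n M‖ := by
  have := norm_sub_givens_mul_le (k := n) hj hc (M := fun a b => M b a) (M' := fun a b => M' b a) h
  have e : trunc n n (fun a b => M' b a) - givens n j (conj z.1, conj z.2) *
      trunc n n (fun a b => M b a) = (trunc n n M' - trunc n n M * (givens n j z)ᴴ)ᵀ := by
    rw [transpose_sub, transpose_mul, givens_conj]
    rfl
  have e' : trunc n n (fun a b => M b a) = (trunc n n M)ᵀ := rfl
  rw [e, e', frobenius_norm_transpose, frobenius_norm_transpose] at this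
  exact this

/-! ### Rounding errors of the elementary operations -/

section Rounding

variable {u : ℝ}

theorem roundoff_nonneg (F : FloatArith u) : 0 ≤ u := by
  obtain ⟨δ, h, _⟩ := F.add_err 0 0
  exact (norm_nonneg _).trans h

theorem norm_mul_one_add_sub_le {x δ : ℂ} (h : ‖δ‖ ≤ u) : ‖x * (1 + δ) - x‖ ≤ u * ‖x‖ := by
  have : x * (1 + δ) - x = δ * x := by ring
  rw [this, norm_mul]
  gcongr

theorem mul_error (F : FloatArith u) (x y : ℂ) : ‖F.mul x y - x * y‖ ≤ u * (‖x‖ * ‖y‖) := by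
  obtain ⟨δ, h, e⟩ := F.mul_err x y
  rw [e, ← norm_mul]
  exact norm_mul_one_add_sub_le h

theorem add_error (F : FloatArith u) (x y : ℂ) : ‖F.add x y - (x + y)‖ ≤ u * ‖x + y‖ := by
  obtain ⟨δ, h, e⟩ := F.add_err x y
  rw [e]
  exact norm_mul_one_add_sub_le h

theorem sub_error (F : FloatArith u) (x y : ℂ) : ‖F.sub x y - (x - y)‖ ≤ u * ‖x - y‖ := by
  obtain ⟨δ, h, e⟩ := F.sub_err x y
  rw [e]
  exact norm_mul_one_add_sub_le h

theorem div_error (F : FloatArith u) (x : ℂ) {y : ℂ} (hy : y ≠ 0) :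
    ‖F.div x y - x / y‖ ≤ u * ‖x / y‖ := by
  obtain ⟨δ, h, e⟩ := F.div_err x y hy
  rw [e]
  exact norm_mul_one_add_sub_le h

theorem absSq_bounds (F : FloatArith u) (x : ℂ) :
    (1 - u) * ‖x‖ ^ 2 ≤ F.absSq x ∧ F.absSq x ≤ (1 + u) * ‖x‖ ^ 2 := by
  obtain ⟨δ, h, e⟩ := F.absSq_err x
  rw [e]
  have := abs_le.1 h
  constructor <;> nlinarith [sq_nonneg ‖x‖]

theorem addR_absSq_bounds (F : FloatArith u) (hu : u ≤ 1 / 10000) (x y : ℂ) :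
    (1 - u) ^ 2 * (‖x‖ ^ 2 + ‖y‖ ^ 2) ≤ F.addR (F.absSq x) (F.absSq y) ∧
      F.addR (F.absSq x) (F.absSq y) ≤ (1 + u) ^ 2 * (‖x‖ ^ 2 + ‖y‖ ^ 2) := by
  obtain ⟨δ, h, e⟩ := F.addR_err (F.absSq x) (F.absSq y)
  have hu0 := roundoff_nonneg F
  have h' := abs_le.1 h
  obtain ⟨a1, a2⟩ := absSq_bounds F x
  obtain ⟨b1, b2⟩ := absSq_bounds F y
  have hx := sq_nonneg ‖x‖
  have hy := sq_nonneg ‖y‖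
  rw [e]
  constructor
  · calc (1 - u) ^ 2 * (‖x‖ ^ 2 + ‖y‖ ^ 2)
        = ((1 - u) * ‖x‖ ^ 2 + (1 - u) * ‖y‖ ^ 2) * (1 - u) := by ring
      _ ≤ (F.absSq x + F.absSq y) * (1 + δ) := by
        have : 0 ≤ (1 - u) * ‖x‖ ^ 2 + (1 - u) * ‖y‖ ^ 2 := by
          have : 0 ≤ 1 - u := by linarith
          positivity
        refine mul_le_mul (by linarith) (by linarith) (by linarith) (by linarith)
  · calc (F.absSq x + F.absSq y) * (1 + δ)
        ≤ ((1 + u) * ‖x‖ ^ 2 + (1 + u) * ‖y‖ ^ 2) * (1 + u) := by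
          refine mul_le_mul (by linarith) (by linarith) (by linarith) (by positivity)
      _ = _ := by ring

/-- The root halves the exponent of `(1 ± u)²` and its own rounding restores it, so the relative
error is `2u` to first order. The squared factors fit the sum of two computed squares; the single
square in the deflation test satisfies them a fortiori. -/
theorem sqrt_bounds (F : FloatArith u) (hu : u ≤ 1 / 10000) {x r : ℝ} (hr : 0 ≤ r)
    (h1 : (1 - u) ^ 2 * r ^ 2 ≤ x) (h2 : x ≤ (1 + u) ^ 2 * r ^ 2) :
    |F.sqrt x - r| ≤ 21 / 10 * u * r := by
  have hu0 := roundoff_nonneg F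
  have hx : 0 ≤ x := le_trans (by positivity) h1
  obtain ⟨δ, h, e⟩ := F.sqrt_err x hx
  have h' := abs_le.1 h
  have s1 : (1 - u) * r ≤ √x := Real.le_sqrt_of_sq_le (by rw [mul_pow]; exact h1)
  have s2 : √x ≤ (1 + u) * r := Real.sqrt_le_iff.2 ⟨by positivity, by rw [mul_pow]; exact h2⟩
  rw [e, abs_le]
  have hur : 0 ≤ u * r := by positivity
  have huur : u * (u * r) ≤ 1 / 10000 * (u * r) := by gcongr
  constructor
  · have : (1 - u) * r * (1 - u) ≤ √x * (1 + δ) :=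
      mul_le_mul s1 (by linarith) (by linarith) (Real.sqrt_nonneg _)
    nlinarith
  · have : √x * (1 + δ) ≤ (1 + u) * r * (1 + u) :=
      mul_le_mul s2 (by linarith) (by linarith) (by positivity)
    nlinarith

/-! ### Computed rotations -/

theorem IsRot.sq_add_sq {z : ℂ × ℂ} (hz : IsRot z) : ‖z.1‖ ^ 2 + ‖z.2‖ ^ 2 = 1 := by
  have h : z.1 * conj z.1 + z.2 * conj z.2 = 1 := hz
  rw [Complex.mul_conj', Complex.mul_conj'] at h
  exact_mod_cast h

theorem IsRot.norm_fst_le {z : ℂ × ℂ} (hz : IsRot z) : ‖z.1‖ ≤ 1 := by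
  have := hz.sq_add_sq
  nlinarith [norm_nonneg z.1, norm_nonneg z.2]

theorem IsRot.norm_snd_le {z : ℂ × ℂ} (hz : IsRot z) : ‖z.2‖ ≤ 1 := by
  have := hz.sq_add_sq
  nlinarith [norm_nonneg z.1, norm_nonneg z.2]

theorem IsRot.conj {z : ℂ × ℂ} (hz : IsRot z) : IsRot (conj z.1, conj z.2) := by
  have h : z.1 * (starRingEnd ℂ) z.1 + z.2 * (starRingEnd ℂ) z.2 = 1 := hz
  simp only [IsRot, Complex.conj_conj]
  rw [← h]
  ring

theorem IsRot.norm_rfst_sq_add {z : ℂ × ℂ} (hz : IsRot z) (a b : ℂ) :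
    ‖rfst z a b‖ ^ 2 + ‖rsnd z a b‖ ^ 2 = ‖a‖ ^ 2 + ‖b‖ ^ 2 := by
  have h : z.1 * (starRingEnd ℂ) z.1 + z.2 * (starRingEnd ℂ) z.2 = 1 := hz
  have : (((‖rfst z a b‖ ^ 2 + ‖rsnd z a b‖ ^ 2 : ℝ)) : ℂ) = ((‖a‖ ^ 2 + ‖b‖ ^ 2 : ℝ) : ℂ) := by
    push_cast
    rw [← Complex.mul_conj', ← Complex.mul_conj', ← Complex.mul_conj', ← Complex.mul_conj']
    simp only [rfst, rsnd, map_sub, map_add, map_mul, Complex.conj_conj]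
    linear_combination (a * (starRingEnd ℂ) a + b * (starRingEnd ℂ) b) * h
  exact_mod_cast this

/-- The pair `R` is a perturbation of order `u` of the exact rotation `z`. -/
structure RotClose (u : ℝ) (R z : ℂ × ℂ) : Prop where
  isRot : IsRot z
  fst : ‖R.1 - z.1‖ ≤ 4 * u
  snd : ‖R.2 - z.2‖ ≤ 4 * u

theorem RotClose.conj {R z : ℂ × ℂ} (h : RotClose u R z) :
    RotClose u (conjRot R) (conj z.1, conj z.2) where
  isRot := h.isRot.conj
  fst := by simpa [conjRot, ← map_sub] using h.fst
  snd := by simpa [conjRot, ← map_sub] using h.snd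

open Classical in
/-- An exact rotation close to `R`, if there is one. -/
def exactRot (u : ℝ) (R : ℂ × ℂ) : ℂ × ℂ :=
  if h : ∃ z, RotClose u R z then h.choose else (1, 0)

theorem isRot_exactRot (u : ℝ) (R : ℂ × ℂ) : IsRot (exactRot u R) := by
  unfold exactRot
  split_ifs with h
  · exact h.choose_spec.isRot
  · simp [IsRot]

/-- The choice depends on `R` alone. Hence the rotation back, which sees only the stored pairs, is
compared with the same unitary matrix as the elimination. -/
theorem rotClose_exactRot {R z : ℂ × ℂ} (h : RotClose u R z) : RotClose u R (exactRot u R) := by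
  have h' : ∃ z, RotClose u R z := ⟨z, h⟩
  rw [exactRot, dif_pos h']
  exact h'.choose_spec

theorem mul_near_error (F : FloatArith u) (hu : u ≤ 1 / 10000) {c z : ℂ} (hz : ‖z‖ ≤ 1)
    (hc : ‖c - z‖ ≤ 4 * u) (a : ℂ) : ‖F.mul c a - z * a‖ ≤ 6 * u * ‖a‖ := by
  have hu0 := roundoff_nonneg F
  have h1 := mul_error F c a
  have hcn : ‖c‖ ≤ 1 + 4 * u := by
    calc ‖c‖ = ‖(c - z) + z‖ := by rw [sub_add_cancel]
      _ ≤ ‖c - z‖ + ‖z‖ := norm_add_le _ _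
      _ ≤ _ := by linarith
  calc ‖F.mul c a - z * a‖ = ‖(F.mul c a - c * a) + (c - z) * a‖ := by ring_nf
    _ ≤ ‖F.mul c a - c * a‖ + ‖c - z‖ * ‖a‖ := by rw [← norm_mul]; exact norm_add_le _ _
    _ ≤ u * ((1 + 4 * u) * ‖a‖) + 4 * u * ‖a‖ := by
      refine add_le_add (h1.trans ?_) ?_ <;> gcongr
    _ = (u * (1 + 4 * u) + 4 * u) * ‖a‖ := by ring
    _ ≤ 6 * u * ‖a‖ := by
      gcongr
      nlinarith

theorem sum_error {w e X : ℂ} {S : ℝ} (hu0 : 0 ≤ u) (hu : u ≤ 1 / 10000) (hX : ‖X - e‖ ≤ 6 * u * S)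
    (hw : ‖w - X‖ ≤ u * ‖X‖) (he : ‖e‖ ≤ S) : ‖w - e‖ ≤ 8 * u * S := by
  have hS : 0 ≤ S := (norm_nonneg _).trans he
  have hXn : ‖X‖ ≤ 6 * u * S + S := by
    calc ‖X‖ = ‖(X - e) + e‖ := by rw [sub_add_cancel]
      _ ≤ ‖X - e‖ + ‖e‖ := norm_add_le _ _
      _ ≤ _ := by linarith
  calc ‖w - e‖ = ‖(w - X) + (X - e)‖ := by ring_nf
    _ ≤ ‖w - X‖ + ‖X - e‖ := norm_add_le _ _
    _ ≤ u * (6 * u * S + S) + 6 * u * S := by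
      refine add_le_add (hw.trans ?_) hX
      gcongr
    _ = (u * (6 * u + 1) + 6 * u) * S := by ring
    _ ≤ 8 * u * S := by
      gcongr
      nlinarith

theorem rotFst_error (F : FloatArith u) (hu : u ≤ 1 / 10000) {R z : ℂ × ℂ} (h : RotClose u R z)
    (a b : ℂ) : ‖rotFst F R a b - rfst z a b‖ ≤ 8 * u * (‖a‖ + ‖b‖) := by
  have h1 := mul_near_error F hu h.isRot.norm_fst_le h.fst a
  have h2 := mul_near_error F hu h.isRot.norm_snd_le h.snd b
  refine sum_error (roundoff_nonneg F) hu ?_ (sub_error F _ _) ?_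
  · calc _ = ‖(F.mul R.1 a - z.1 * a) - (F.mul R.2 b - z.2 * b)‖ := by rw [rfst]; ring_nf
      _ ≤ _ := norm_sub_le _ _
      _ ≤ _ := by linarith
  · refine (norm_sub_le _ _).trans ?_
    rw [norm_mul, norm_mul]
    exact add_le_add (mul_le_of_le_one_left (norm_nonneg _) h.isRot.norm_fst_le)
      (mul_le_of_le_one_left (norm_nonneg _) h.isRot.norm_snd_le)

theorem rotSnd_error (F : FloatArith u) (hu : u ≤ 1 / 10000) {R z : ℂ × ℂ} (h : RotClose u R z)
    (a b : ℂ) : ‖rotSnd F R a b - rsnd z a b‖ ≤ 8 * u * (‖a‖ + ‖b‖) := by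
  have h' := h.conj
  have h1 := mul_near_error F hu h'.isRot.norm_snd_le h'.snd a
  have h2 := mul_near_error F hu h'.isRot.norm_fst_le h'.fst b
  refine sum_error (roundoff_nonneg F) hu ?_ (add_error F _ _) ?_
  · calc _ = ‖(F.mul (conj R.2) a - conj z.2 * a) + (F.mul (conj R.1) b - conj z.1 * b)‖ := by
          rw [rsnd]; ring_nf
      _ ≤ _ := norm_add_le _ _
      _ ≤ _ := by simp only [conjRot] at h1 h2; linarith
  · refine (norm_add_le _ _).trans ?_
    rw [norm_mul, norm_mul]
    exact add_le_add (mul_le_of_le_one_left (norm_nonneg _) h'.isRot.norm_snd_le)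
      (mul_le_of_le_one_left (norm_nonneg _) h'.isRot.norm_fst_le)

theorem div_near_error {x δ : ℂ} {r r' : ℝ} (hu0 : 0 ≤ u) (hu : u ≤ 1 / 10000) (hr : 0 < r)
    (hr' : |r' - r| ≤ 21 / 10 * u * r) (hδ : ‖δ‖ ≤ u) (hx : ‖x‖ ≤ r) :
    ‖x / (r' : ℂ) * (1 + δ) - x / r‖ ≤ 4 * u := by
  have h1 := abs_le.1 hr'
  have hlow : (9 / 10) * r ≤ r' := by nlinarith
  have hpos : 0 < r' := by nlinarith
  have c1 : (r : ℂ) ≠ 0 := by exact_mod_cast hr.ne'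
  have c2 : (r' : ℂ) ≠ 0 := by exact_mod_cast hpos.ne'
  have e : x / (r' : ℂ) * (1 + δ) - x / r = (x / r) * ((((r - r' : ℝ) : ℂ) + r * δ) / r') := by
    push_cast
    field_simp
    ring
  rw [e, norm_mul, norm_div, norm_div, Complex.norm_real, Complex.norm_real,
    Real.norm_of_nonneg hr.le, Real.norm_of_nonneg hpos.le]
  have n1 : ‖x‖ / r ≤ 1 := (div_le_one hr).2 hx
  have n2 : ‖((r - r' : ℝ) : ℂ) + r * δ‖ ≤ 21 / 10 * u * r + r * u := by
    refine (norm_add_le _ _).trans (add_le_add ?_ ?_)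
    · rw [Complex.norm_real, Real.norm_eq_abs, abs_sub_comm]; exact hr'
    · rw [norm_mul, Complex.norm_real, Real.norm_of_nonneg hr.le]; gcongr
  have n3 : ‖((r - r' : ℝ) : ℂ) + r * δ‖ / r' ≤ 4 * u := by
    rw [div_le_iff₀ hpos]
    nlinarith [mul_nonneg hu0 hr.le]
  calc _ ≤ 1 * (4 * u) := by gcongr
    _ = _ := one_mul _

/-- The witness divides by the exact `r`. The bound `4u` covers the `2.1u` of the computed `r` and
the `u` of the division. The annihilation property is needed only for the residual; elsewhere any
exact rotation close to the computed one will do. -/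
theorem mkRot_spec (F : FloatArith u) (hu : u ≤ 1 / 10000) (x y : ℂ) :
    ∃ z, RotClose u (mkRot F x y) z ∧ rfst z x y = 0 := by
  have hu0 := roundoff_nonneg F
  unfold mkRot
  split_ifs with h
  · refine ⟨(1, 0), ⟨by simp [IsRot], by simp [hu0], by simp [hu0]⟩, by simp [rfst, h.1]⟩
  · set r : ℝ := √(‖x‖ ^ 2 + ‖y‖ ^ 2) with hrdef
    have hpos : 0 < ‖x‖ ^ 2 + ‖y‖ ^ 2 := by
      by_cases hx : x = 0
      · have hy : y ≠ 0 := fun hy => h ⟨hx, hy⟩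
        positivity
      · positivity
    have hr : 0 < r := Real.sqrt_pos.2 hpos
    have hr2 : r ^ 2 = ‖x‖ ^ 2 + ‖y‖ ^ 2 := Real.sq_sqrt hpos.le
    have hxr : ‖x‖ ≤ r := Real.le_sqrt_of_sq_le (by nlinarith [sq_nonneg ‖y‖])
    have hyr : ‖y‖ ≤ r := Real.le_sqrt_of_sq_le (by nlinarith [sq_nonneg ‖x‖])
    obtain ⟨b1, b2⟩ := addR_absSq_bounds F hu x y
    rw [← hr2] at b1 b2
    have hs := sqrt_bounds F hu hr.le b1 b2
    set r' := F.sqrt (F.addR (F.absSq x) (F.absSq y))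
    have hne : (r' : ℂ) ≠ 0 := by
      have : 0 < r' := by have := abs_le.1 hs; nlinarith
      exact_mod_cast this.ne'
    have c1 : (r : ℂ) ≠ 0 := by exact_mod_cast hr.ne'
    obtain ⟨δ1, hδ1, e1⟩ := F.div_err y r' hne
    obtain ⟨δ2, hδ2, e2⟩ := F.div_err x r' hne
    refine ⟨(y / r, x / r), ⟨?_, ?_, ?_⟩, ?_⟩
    · have : (r : ℂ) ^ 2 = x * conj x + y * conj y := by
        rw [Complex.mul_conj', Complex.mul_conj']; exact_mod_cast hr2
      simp only [IsRot, map_div₀, Complex.conj_ofReal]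
      field_simp
      rw [this]; ring
    · simp only [e1]; exact div_near_error hu0 hu hr hs hδ1 hyr
    · simp only [e2]; exact div_near_error hu0 hu hr hs hδ2 hxr
    · simp only [rfst]; ring

/-! ### Residual of the elimination and the correction of `p` -/

theorem fused_error (F : FloatArith u) (hu : u ≤ 1 / 10000) (a p q : ℂ) :
    ‖F.add a (F.mul p q) - (a + p * q)‖ ≤ 3 * u * (‖a‖ + ‖p * q‖) := by
  have hu0 := roundoff_nonneg F
  have h1 := mul_error F p q
  have h2 := add_error F a (F.mul p q)
  rw [← norm_mul] at h1
  have h3 : ‖a + F.mul p q‖ ≤ ‖a‖ + ‖p * q‖ + u * ‖p * q‖ := by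
    calc ‖a + F.mul p q‖ = ‖a + p * q + (F.mul p q - p * q)‖ := by ring_nf
      _ ≤ ‖a‖ + ‖p * q‖ + ‖F.mul p q - p * q‖ := norm_add₃_le
      _ ≤ _ := by linarith
  have ha := norm_nonneg a
  have hp := norm_nonneg (p * q)
  calc ‖F.add a (F.mul p q) - (a + p * q)‖
      = ‖(F.add a (F.mul p q) - (a + F.mul p q)) + (F.mul p q - p * q)‖ := by ring_nf
    _ ≤ _ := norm_add_le _ _
    _ ≤ u * (‖a‖ + ‖p * q‖ + u * ‖p * q‖) + u * ‖p * q‖ := by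
      refine add_le_add (h2.trans ?_) h1
      gcongr
    _ ≤ 3 * u * (‖a‖ + ‖p * q‖) := by
      have : u * (u * ‖p * q‖) ≤ 1 / 10000 * (u * ‖p * q‖) := by gcongr
      nlinarith [mul_nonneg hu0 ha, mul_nonneg hu0 hp]

/-- The computed rotated pair has roughly the size of the original pair. -/
theorem rot_size (F : FloatArith u) (hu : u ≤ 1 / 10000) {R z : ℂ × ℂ} (h : RotClose u R z)
    (a b : ℂ) :
    18 / 100 * (‖a‖ + ‖b‖) ^ 2 ≤ ‖rotFst F R a b‖ ^ 2 + ‖rotSnd F R a b‖ ^ 2 ∧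
      ‖rotFst F R a b‖ ^ 2 + ‖rotSnd F R a b‖ ^ 2 ≤ 22 / 10 * (‖a‖ + ‖b‖) ^ 2 := by
  have hu0 := roundoff_nonneg F
  have e1 := rotFst_error F hu h a b
  have e2 := rotSnd_error F hu h a b
  have hn := h.isRot.norm_rfst_sq_add a b
  set X := rotFst F R a b
  set Y := rotSnd F R a b
  set x := rfst z a b
  set y := rsnd z a b
  have ha := norm_nonneg a
  have hb := norm_nonneg b
  set S := ‖a‖ + ‖b‖ with hS
  have hS0 : 0 ≤ S := by positivity
  have hsmall : 8 * u * S ≤ 1 / 1000 * S := by gcongr; linarith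
  have d1 : |‖X‖ - ‖x‖| ≤ 1 / 1000 * S := (abs_norm_sub_norm_le _ _).trans (e1.trans hsmall)
  have d2 : |‖Y‖ - ‖y‖| ≤ 1 / 1000 * S := (abs_norm_sub_norm_le _ _).trans (e2.trans hsmall)
  have l1 := abs_le.1 d1
  have l2 := abs_le.1 d2
  have hx := norm_nonneg x
  have hy := norm_nonneg y
  have hX := norm_nonneg X
  have hY := norm_nonneg Y
  have s1 : S ^ 2 ≤ 2 * (‖x‖ ^ 2 + ‖y‖ ^ 2) := by
    rw [hn, hS]; nlinarith [sq_nonneg (‖a‖ - ‖b‖)]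
  have s2 : ‖x‖ ^ 2 + ‖y‖ ^ 2 ≤ S ^ 2 := by rw [hn, hS]; nlinarith
  have xS : ‖x‖ ≤ S := by nlinarith
  have yS : ‖y‖ ≤ S := by nlinarith
  have q1 : (‖X‖ - ‖x‖) * (‖X‖ + ‖x‖) ≤ 1 / 1000 * S * (3 * S) :=
    (le_abs_self _).trans (by
      rw [abs_mul, abs_of_nonneg (by positivity : 0 ≤ ‖X‖ + ‖x‖)]
      gcongr
      linarith)
  have q1' : -(1 / 1000 * S * (3 * S)) ≤ (‖X‖ - ‖x‖) * (‖X‖ + ‖x‖) :=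
    neg_le_of_abs_le (by
      rw [abs_mul, abs_of_nonneg (by positivity : 0 ≤ ‖X‖ + ‖x‖)]
      gcongr
      linarith)
  have q2 : (‖Y‖ - ‖y‖) * (‖Y‖ + ‖y‖) ≤ 1 / 1000 * S * (3 * S) :=
    (le_abs_self _).trans (by
      rw [abs_mul, abs_of_nonneg (by positivity : 0 ≤ ‖Y‖ + ‖y‖)]
      gcongr
      linarith)
  have q2' : -(1 / 1000 * S * (3 * S)) ≤ (‖Y‖ - ‖y‖) * (‖Y‖ + ‖y‖) :=
    neg_le_of_abs_le (by
      rw [abs_mul, abs_of_nonneg (by positivity : 0 ≤ ‖Y‖ + ‖y‖)]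
      gcongr
      linarith)
  constructor <;> nlinarith

theorem norm_sum_mul_bounds (F : FloatArith u) (hu : u ≤ 1 / 10000) (x y q : ℂ) :
    99 / 100 * ((‖x‖ ^ 2 + ‖y‖ ^ 2) * ‖q‖ ^ 2) ≤
        F.addR (F.absSq (F.mul x q)) (F.absSq (F.mul y q)) ∧
      F.addR (F.absSq (F.mul x q)) (F.absSq (F.mul y q)) ≤
        101 / 100 * ((‖x‖ ^ 2 + ‖y‖ ^ 2) * ‖q‖ ^ 2) := by
  have hu0 := roundoff_nonneg F
  obtain ⟨b1, b2⟩ := addR_absSq_bounds F hu (F.mul x q) (F.mul y q)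
  have key : ∀ x : ℂ, (1 - 2 * u) * (‖x‖ ^ 2 * ‖q‖ ^ 2) ≤ ‖F.mul x q‖ ^ 2 ∧
      ‖F.mul x q‖ ^ 2 ≤ (1 + 3 * u) * (‖x‖ ^ 2 * ‖q‖ ^ 2) := by
    intro x
    have h := mul_error F x q
    rw [← norm_mul] at h
    have h' := abs_le.1 ((abs_norm_sub_norm_le _ _).trans h)
    rw [← mul_pow, ← norm_mul]
    have hn := norm_nonneg (x * q)
    have huu : u ^ 2 ≤ 1 / 10000 * u := by nlinarith
    constructor
    · calc (1 - 2 * u) * ‖x * q‖ ^ 2 ≤ ((1 - u) * ‖x * q‖) ^ 2 := by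
            rw [mul_pow]; gcongr; nlinarith
        _ ≤ _ := by
            refine pow_le_pow_left₀ (mul_nonneg (by linarith) hn) (by linarith) 2
    · calc ‖F.mul x q‖ ^ 2 ≤ ((1 + u) * ‖x * q‖) ^ 2 := by
            refine pow_le_pow_left₀ (norm_nonneg _) (by linarith) 2
        _ ≤ _ := by rw [mul_pow]; gcongr; nlinarith
  obtain ⟨k1, k2⟩ := key x
  obtain ⟨k3, k4⟩ := key y
  set T := (‖x‖ ^ 2 + ‖y‖ ^ 2) * ‖q‖ ^ 2 with hT
  have hT0 : 0 ≤ T := by positivity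
  have t1 : (1 - 2 * u) * T ≤ ‖F.mul x q‖ ^ 2 + ‖F.mul y q‖ ^ 2 := by rw [hT]; linarith
  have t2 : ‖F.mul x q‖ ^ 2 + ‖F.mul y q‖ ^ 2 ≤ (1 + 3 * u) * T := by rw [hT]; linarith
  constructor
  · refine le_trans ?_ b1
    calc 99 / 100 * T ≤ 999 / 1000 * (999 / 1000 * T) := by linarith
      _ ≤ (1 - u) ^ 2 * ((1 - 2 * u) * T) := by
        refine mul_le_mul (by nlinarith) (by gcongr; linarith) (by positivity) (by positivity)
      _ ≤ _ := by gcongr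
  · refine b2.trans ?_
    calc _ ≤ (1 + u) ^ 2 * ((1 + 3 * u) * T) := by gcongr
      _ ≤ (1001 / 1000) * ((1001 / 1000) * T) := by
        refine mul_le_mul (by nlinarith) (by gcongr; linarith) ?_ (by positivity)
        exact mul_nonneg (by linarith) hT0
      _ ≤ _ := by linarith

theorem addR_absSq_bounds' (F : FloatArith u) (hu : u ≤ 1 / 10000) (x y : ℂ) :
    99 / 100 * (‖x‖ ^ 2 + ‖y‖ ^ 2) ≤ F.addR (F.absSq x) (F.absSq y) ∧
      F.addR (F.absSq x) (F.absSq y) ≤ 101 / 100 * (‖x‖ ^ 2 + ‖y‖ ^ 2) := by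
  have hu0 := roundoff_nonneg F
  obtain ⟨b1, b2⟩ := addR_absSq_bounds F hu x y
  constructor
  · refine le_trans ?_ b1
    gcongr
    nlinarith
  · refine b2.trans ?_
    gcongr
    nlinarith

/-- The computed first entry of the rotated `p`, after the correction. -/
def corrected (F : FloatArith u) (qc βj dj1 pj pj1 : ℂ) : ℂ :=
  open Classical in
  if F.addR (F.absSq (F.mul pj qc)) (F.absSq (F.mul pj1 qc)) >
      F.addR (F.absSq βj) (F.absSq dj1)
  then -(F.div βj qc) else pj

/-- In floating point arithmetic the superdiagonal entry is eliminated up to a small residual. -/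
theorem residual_bound (F : FloatArith u) (hu : u ≤ 1 / 10000) (β d p₀ p₁ qc : ℂ) {R : ℂ × ℂ}
    (hR : R = mkRot F (F.add β (F.mul p₀ qc)) (F.add d (F.mul p₁ qc))) :
    ‖rotFst F R β d + rotFst F R p₀ p₁ * qc‖ ≤
      30 * u * ((‖β‖ + ‖d‖) + (‖p₀‖ + ‖p₁‖) * ‖qc‖) := by
  have hu0 := roundoff_nonneg F
  obtain ⟨w, hw, hw0⟩ := mkRot_spec F hu (F.add β (F.mul p₀ qc)) (F.add d (F.mul p₁ qc))
  rw [← hR] at hw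
  have f1 := fused_error F hu β p₀ qc
  have f2 := fused_error F hu d p₁ qc
  have g1 := rotFst_error F hu hw β d
  have g2 := rotFst_error F hu hw p₀ p₁
  set x := F.add β (F.mul p₀ qc)
  set y := F.add d (F.mul p₁ qc)
  rw [norm_mul] at f1 f2
  -- The rotation `w` annihilates the computed pair `(x, y)` exactly. What remains is the rounding
  -- of the two rotations and the deviation of `x`, `y` from the exact sums.
  have e : rotFst F R β d + rotFst F R p₀ p₁ * qc =
      (rotFst F R β d - rfst w β d) + (rotFst F R p₀ p₁ - rfst w p₀ p₁) * qc -
        (w.1 * (x - (β + p₀ * qc)) - w.2 * (y - (d + p₁ * qc))) := by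
    simp only [rfst] at hw0 ⊢
    linear_combination hw0
  rw [e]
  have n1 : ‖w.1 * (x - (β + p₀ * qc))‖ ≤ 3 * u * (‖β‖ + ‖p₀‖ * ‖qc‖) := by
    rw [norm_mul]
    exact (mul_le_of_le_one_left (norm_nonneg _) hw.isRot.norm_fst_le).trans f1
  have n2 : ‖w.2 * (y - (d + p₁ * qc))‖ ≤ 3 * u * (‖d‖ + ‖p₁‖ * ‖qc‖) := by
    rw [norm_mul]
    exact (mul_le_of_le_one_left (norm_nonneg _) hw.isRot.norm_snd_le).trans f2
  have n3 : ‖(rotFst F R p₀ p₁ - rfst w p₀ p₁) * qc‖ ≤ 8 * u * (‖p₀‖ + ‖p₁‖) * ‖qc‖ := by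
    rw [norm_mul]; gcongr
  have hB : 0 ≤ u * (‖β‖ + ‖d‖) := by positivity
  have hP : 0 ≤ u * ((‖p₀‖ + ‖p₁‖) * ‖qc‖) := by positivity
  calc _ ≤ (8 * u * (‖β‖ + ‖d‖) + 8 * u * (‖p₀‖ + ‖p₁‖) * ‖qc‖) +
        (3 * u * (‖β‖ + ‖p₀‖ * ‖qc‖) + 3 * u * (‖d‖ + ‖p₁‖ * ‖qc‖)) :=
        (norm_sub_le _ _).trans (add_le_add ((norm_add_le _ _).trans (add_le_add g1 n3))
          ((norm_sub_le _ _).trans (add_le_add n1 n2)))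
    _ ≤ _ := by linarith

/-- Both sides of the correction test are comparable with the data before the rotation. -/
theorem test_bounds (F : FloatArith u) (hu : u ≤ 1 / 10000) (β d p₀ p₁ qc : ℂ) {R z : ℂ × ℂ}
    (hz : RotClose u R z) :
    (F.addR (F.absSq (F.mul (rotFst F R p₀ p₁) qc)) (F.absSq (F.mul (rotSnd F R p₀ p₁) qc)) >
        F.addR (F.absSq (rotFst F R β d)) (F.absSq (rotSnd F R β d)) →
      ‖β‖ + ‖d‖ ≤ 5 * ((‖p₀‖ + ‖p₁‖) * ‖qc‖) ∧ 0 < (‖p₀‖ + ‖p₁‖) * ‖qc‖) ∧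
    (¬ F.addR (F.absSq (F.mul (rotFst F R p₀ p₁) qc)) (F.absSq (F.mul (rotSnd F R p₀ p₁) qc)) >
        F.addR (F.absSq (rotFst F R β d)) (F.absSq (rotSnd F R β d)) →
      (‖p₀‖ + ‖p₁‖) * ‖qc‖ ≤ 5 * (‖β‖ + ‖d‖)) := by
  obtain ⟨sβ1, sβ2⟩ := rot_size F hu hz β d
  obtain ⟨sp1, sp2⟩ := rot_size F hu hz p₀ p₁
  obtain ⟨tβ1, tβ2⟩ := addR_absSq_bounds' F hu (rotFst F R β d) (rotSnd F R β d)
  obtain ⟨tp1, tp2⟩ := norm_sum_mul_bounds F hu (rotFst F R p₀ p₁) (rotSnd F R p₀ p₁) qc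
  generalize rotFst F R β d = β' at *
  generalize rotSnd F R β d = d' at *
  generalize rotFst F R p₀ p₁ = pj at *
  generalize rotSnd F R p₀ p₁ = pj1 at *
  have hB : 0 ≤ ‖β‖ + ‖d‖ := by positivity
  have hP : 0 ≤ ‖p₀‖ + ‖p₁‖ := by positivity
  generalize ‖β‖ + ‖d‖ = B at *
  generalize ‖p₀‖ + ‖p₁‖ = P at *
  have hq := norm_nonneg qc
  have hPq : 0 ≤ P * ‖qc‖ := by positivity
  have m1 := mul_le_mul_of_nonneg_right sp1 (sq_nonneg ‖qc‖)
  have m2 := mul_le_mul_of_nonneg_right sp2 (sq_nonneg ‖qc‖)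
  rw [mul_assoc, ← mul_pow] at m1 m2
  have hsq := sq_nonneg (P * ‖qc‖)
  have hsB := sq_nonneg B
  refine ⟨fun hc => ?_, fun hc => ?_⟩
  · constructor
    -- The test and `rot_size` give `0.99 · 0.18 · B² ≤ 1.01 · 2.2 · (P‖qc‖)²`, a ratio below 13, so
    -- the factor 5 has slack.
    · refine (sq_le_sq₀ hB (by positivity)).1 ?_
      rw [mul_pow 5]
      linarith
    · rcases hPq.eq_or_lt with h0 | h0
      · exfalso
        rw [← h0] at m2
        have : 0 ≤ ‖β'‖ ^ 2 + ‖d'‖ ^ 2 := by positivity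
        linarith
      · exact h0
  · refine (sq_le_sq₀ hPq (by positivity)).1 ?_
    rw [mul_pow 5]
    linarith

/-- After the correction one number `p_j` serves two purposes: it is the rotated `p`, with an error
relative to the pair of `p`, and it generates the eliminated entry of `A`, with an error relative to
the pair of `A`. The test detects which of the two could absorb the residual and lets that one do
so. -/
theorem corrected_bounds (F : FloatArith u) (hu : u ≤ 1 / 10000) (β d p₀ p₁ qc : ℂ) {R z : ℂ × ℂ}
    (hR : R = mkRot F (F.add β (F.mul p₀ qc)) (F.add d (F.mul p₁ qc))) (hz : RotClose u R z) :
    ‖corrected F qc (rotFst F R β d) (rotSnd F R β d) (rotFst F R p₀ p₁) (rotSnd F R p₀ p₁) -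
        rfst z p₀ p₁‖ ≤ 200 * u * (‖p₀‖ + ‖p₁‖) ∧
      ‖-(corrected F qc (rotFst F R β d) (rotSnd F R β d) (rotFst F R p₀ p₁) (rotSnd F R p₀ p₁) *
        qc) - rfst z β d‖ ≤ 200 * u * (‖β‖ + ‖d‖) := by
  have hu0 := roundoff_nonneg F
  have hres := residual_bound F hu β d p₀ p₁ qc hR
  have gβ := rotFst_error F hu hz β d
  have gp := rotFst_error F hu hz p₀ p₁
  obtain ⟨t1, t2⟩ := test_bounds F hu β d p₀ p₁ qc hz
  obtain ⟨-, sβ⟩ := rot_size F hu hz β d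
  unfold corrected
  generalize rotFst F R β d = β' at *
  generalize rotSnd F R β d = d' at *
  generalize rotFst F R p₀ p₁ = pj at *
  generalize rotSnd F R p₀ p₁ = pj1 at *
  generalize rfst z β d = xβ at *
  generalize rfst z p₀ p₁ = xp at *
  clear hR hz
  have hB : 0 ≤ ‖β‖ + ‖d‖ := by positivity
  have hP : 0 ≤ ‖p₀‖ + ‖p₁‖ := by positivity
  generalize ‖β‖ + ‖d‖ = B at *
  generalize ‖p₀‖ + ‖p₁‖ = P at *
  have hq := norm_nonneg qc
  have huB : 0 ≤ u * B := by positivity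
  have huP : 0 ≤ u * P := by positivity
  split_ifs with hc
  · obtain ⟨hBP, hPpos⟩ := t1 hc
    have hq0 : 0 < ‖qc‖ := pos_of_mul_pos_right hPpos hP
    have hqne : qc ≠ 0 := norm_pos_iff.1 hq0
    have hd := div_error F β' hqne
    generalize F.div β' qc = w at *
    have hβ' : ‖β'‖ ≤ 2 * B := by
      refine (sq_le_sq₀ (norm_nonneg _) (by positivity)).1 ?_
      rw [mul_pow 2]
      linarith [sq_nonneg ‖d'‖, sq_nonneg B]
    constructor
    -- The residual is at most `30u(5 + 1)P‖qc‖`. Adding `10u P` for the division and `8u P` for the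
    -- rotation of `p` gives `198u P`, which fixes the constant 200.
    · have r1 : ‖β' / qc + pj‖ ≤ 180 * u * P := by
        have : β' / qc + pj = (β' + pj * qc) / qc := by field_simp
        rw [this, norm_div, div_le_iff₀ hq0]
        refine hres.trans ?_
        have : u * B ≤ u * (5 * (P * ‖qc‖)) := by gcongr
        linarith
      have r2 : u * ‖β' / qc‖ ≤ 10 * u * P := by
        have : ‖β' / qc‖ ≤ 10 * P := by
          rw [norm_div, div_le_iff₀ hq0]
          linarith
        calc u * ‖β' / qc‖ ≤ u * (10 * P) := by gcongr
          _ = _ := by ring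
      have e : -w - xp = -(w - β' / qc) - (β' / qc + pj) + (pj - xp) := by ring
      have n := norm_add_le (-(w - β' / qc) - (β' / qc + pj)) (pj - xp)
      have n' := norm_sub_le (-(w - β' / qc)) (β' / qc + pj)
      rw [norm_neg] at n'
      rw [e]
      linarith
    · have r1 : ‖(w - β' / qc) * qc‖ ≤ u * (2 * B) := by
        rw [norm_mul]
        calc _ ≤ u * ‖β' / qc‖ * ‖qc‖ := by gcongr
          _ = u * ‖β'‖ := by rw [norm_div, mul_assoc, div_mul_cancel₀ _ hq0.ne']
          _ ≤ _ := by gcongr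
      have e : -(-w * qc) - xβ = (w - β' / qc) * qc + (β' - xβ) := by
        rw [sub_mul, div_mul_cancel₀ _ hqne]; ring
      rw [e]
      refine (norm_add_le _ _).trans ?_
      linarith
  -- Without correction `p` has only its rotation error, and now the residual is at most `30u(1 +
  -- 5)B`.
  · have hPB := t2 hc
    refine ⟨by linarith, ?_⟩
    have e : -(pj * qc) - xβ = -(β' + pj * qc) + (β' - xβ) := by ring
    have n := norm_add_le (-(β' + pj * qc)) (β' - xβ)
    rw [norm_neg] at n
    rw [e]
    have : u * (P * ‖qc‖) ≤ u * (5 * B) := by gcongr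
    linarith

end Rounding

/-! ### The elimination of the superdiagonal -/

section Elim

variable {u : ℝ}

/-- With `y = conj (q b)`, a relative error in the rotated `p` is the same relative error in the
entries `-(p a * y)` of column `b`, so the generated part of `A` inherits its bound from `p`. -/
theorem scaled_fst_error {c : ℝ} {z : ℂ × ℂ} {x x₀ x₁ : ℂ} (y : ℂ)
    (h : ‖x - rfst z x₀ x₁‖ ≤ c * (‖x₀‖ + ‖x₁‖)) :
    ‖-(x * y) - rfst z (-(x₀ * y)) (-(x₁ * y))‖ ≤ c * (‖-(x₀ * y)‖ + ‖-(x₁ * y)‖) := by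
  have e : -(x * y) - rfst z (-(x₀ * y)) (-(x₁ * y)) = -((x - rfst z x₀ x₁) * y) := by
    simp only [rfst]; ring
  rw [e, norm_neg, norm_neg, norm_neg, norm_mul, norm_mul, norm_mul, ← add_mul, ← mul_assoc]
  gcongr

theorem scaled_snd_error {c : ℝ} {z : ℂ × ℂ} {x x₀ x₁ : ℂ} (y : ℂ)
    (h : ‖x - rsnd z x₀ x₁‖ ≤ c * (‖x₀‖ + ‖x₁‖)) :
    ‖-(x * y) - rsnd z (-(x₀ * y)) (-(x₁ * y))‖ ≤ c * (‖-(x₀ * y)‖ + ‖-(x₁ * y)‖) := by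
  have e : -(x * y) - rsnd z (-(x₀ * y)) (-(x₁ * y)) = -((x - rsnd z x₀ x₁) * y) := by
    simp only [rsnd]; ring
  rw [e, norm_neg, norm_neg, norm_neg, norm_mul, norm_mul, norm_mul, ← add_mul, ← mul_assoc]
  gcongr

/-- Error of the first rotated entry when the second argument is a computed product. -/
theorem rotFst_mul_error (F : FloatArith u) (hu : u ≤ 1 / 10000) {R z : ℂ × ℂ}
    (h : RotClose u R z) (a x y : ℂ) :
    ‖rotFst F R a (-F.mul x y) - rfst z a (-(x * y))‖ ≤ 10 * u * (‖a‖ + ‖-(x * y)‖) := by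
  have hu0 := roundoff_nonneg F
  have h1 := rotFst_error F hu h a (-F.mul x y)
  have h2 := mul_error F x y
  rw [← norm_mul] at h2
  rw [norm_neg] at h1 ⊢
  have h3 : ‖F.mul x y‖ ≤ ‖x * y‖ + u * ‖x * y‖ := by
    calc ‖F.mul x y‖ = ‖x * y + (F.mul x y - x * y)‖ := by ring_nf
      _ ≤ _ := (norm_add_le _ _).trans (by gcongr)
  have h4 : ‖z.2 * (F.mul x y - x * y)‖ ≤ u * ‖x * y‖ := by
    rw [norm_mul]
    exact (mul_le_of_le_one_left (norm_nonneg _) h.isRot.norm_snd_le).trans h2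
  have e : rotFst F R a (-F.mul x y) - rfst z a (-(x * y)) =
      (rotFst F R a (-F.mul x y) - rfst z a (-F.mul x y)) + z.2 * (F.mul x y - x * y) := by
    simp only [rfst]; ring
  rw [e]
  refine (norm_add_le _ _).trans ((add_le_add h1 h4).trans ?_)
  have ha := norm_nonneg a
  have hx := norm_nonneg (x * y)
  have k1 : u * ‖F.mul x y‖ ≤ u * (‖x * y‖ + u * ‖x * y‖) := by gcongr
  have k2 : u * (u * ‖x * y‖) ≤ 1 / 10000 * (u * ‖x * y‖) := by gcongr
  have k3 := mul_nonneg hu0 hx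
  have k4 := mul_nonneg hu0 ha
  linarith

/-- Error of the second rotated entry when the second argument is a computed product. -/
theorem rotSnd_mul_error (F : FloatArith u) (hu : u ≤ 1 / 10000) {R z : ℂ × ℂ}
    (h : RotClose u R z) (a x y : ℂ) :
    ‖rotSnd F R a (-F.mul x y) - rsnd z a (-(x * y))‖ ≤ 10 * u * (‖a‖ + ‖-(x * y)‖) := by
  have hu0 := roundoff_nonneg F
  have h1 := rotSnd_error F hu h a (-F.mul x y)
  have h2 := mul_error F x y
  rw [← norm_mul] at h2
  rw [norm_neg] at h1 ⊢
  have h3 : ‖F.mul x y‖ ≤ ‖x * y‖ + u * ‖x * y‖ := by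
    calc ‖F.mul x y‖ = ‖x * y + (F.mul x y - x * y)‖ := by ring_nf
      _ ≤ _ := (norm_add_le _ _).trans (by gcongr)
  have h4 : ‖conj z.1 * (F.mul x y - x * y)‖ ≤ u * ‖x * y‖ := by
    rw [norm_mul]
    exact (mul_le_of_le_one_left (norm_nonneg _) h.conj.isRot.norm_fst_le).trans h2
  have e : rotSnd F R a (-F.mul x y) - rsnd z a (-(x * y)) =
      (rotSnd F R a (-F.mul x y) - rsnd z a (-F.mul x y)) - conj z.1 * (F.mul x y - x * y) := by
    simp only [rsnd]; ring
  rw [e]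
  refine (norm_sub_le _ _).trans ((add_le_add h1 h4).trans ?_)
  have ha := norm_nonneg a
  have hx := norm_nonneg (x * y)
  have k1 : u * ‖F.mul x y‖ ≤ u * (‖x * y‖ + u * ‖x * y‖) := by gcongr
  have k2 : u * (u * ‖x * y‖) ≤ 1 / 10000 * (u * ‖x * y‖) := by gcongr
  have k3 := mul_nonneg hu0 hx
  have k4 := mul_nonneg hu0 ha
  linarith

/-- The variables of the elimination, after the superdiagonal entries in the rows `≥ J` have been
eliminated, describe the matrix `M`. -/
structure ElimInv (n i J : ℕ) (q : ℕ → ℂ) (s : ElimState) (M : ℕ → ℕ → ℂ) : Prop where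
  diag : ∀ a < n, M a a = s.d a
  super : ∀ a, i ≤ a → a < J → M a (a + 1) = s.β a
  upper : ∀ a b, a < b → b < n → (a + 1 < b ∨ a < i ∨ J ≤ a) → M a b = -(s.p a * conj (q b))
  sub : ∀ a, i ≤ a → a + 1 < n → M (a + 1) a = s.γ a
  -- The row rotations act on `qt` here, while `p b` is still untouched because `b < J`. Rows below
  -- `J` are left out: their entries below the subdiagonal are not read again.
  lower : ∀ a b, i ≤ b → b + 1 < a → a ≤ J → M a b = -(s.qt a * conj (s.p b))

/-- The rotation computed in an elimination step. -/
def elimRot (F : FloatArith u) (q : ℕ → ℂ) (j : ℕ) (s : ElimState) : ℂ × ℂ :=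
  mkRot F (F.add (s.β j) (F.mul (s.p j) (conj (q (j + 1)))))
    (F.add (s.d (j + 1)) (F.mul (s.p (j + 1)) (conj (q (j + 1)))))

section Step

variable (F : FloatArith u) (q : ℕ → ℂ) (i j : ℕ) (s : ElimState)

theorem elimStep_Q : (elimStep F q i j s).Q = Function.update s.Q j (elimRot F q j s) := rfl

theorem elimStep_β_of_ne {a : ℕ} (h : a ≠ j) : (elimStep F q i j s).β a = s.β a := by
  simp [elimStep, h]

theorem elimStep_γ_of_ne {a : ℕ} (h : a ≠ j) (h' : i ≤ a → a + 1 ≠ j) (hi : i ≤ a) (hij : i ≤ j) :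
    (elimStep F q i j s).γ a = s.γ a := by
  by_cases hji : j = i
  · subst hji; simp [elimStep, h]
  · have : a ≠ j - 1 := by have := h' hi; omega
    simp [elimStep, h, hji, this]

theorem elimStep_γ_pred {a : ℕ} (h : a + 1 = j) (hi : i ≤ a) :
    (elimStep F q i j s).γ a =
      rotFst F (elimRot F q j s) (s.γ a) (-(F.mul (s.qt (j + 1)) (conj (s.p a)))) := by
  subst h
  have : a + 1 ≠ i := by omega
  simp [elimStep, elimRot, this]

theorem elimStep_γ_self (hij : i ≤ j) :
    (elimStep F q i j s).γ j = rotSnd F (elimRot F q j s) (s.d j) (s.γ j) := by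
  by_cases hji : j = i
  · subst hji; simp [elimStep, elimRot]
  · have : j ≠ j - 1 := by omega
    simp [elimStep, elimRot, hji, this]

theorem elimStep_d_self (hij : i ≤ j) :
    (elimStep F q i j s).d j = rotFst F (elimRot F q j s) (s.d j) (s.γ j) := by
  by_cases hji : j = i
  · subst hji; simp [elimStep, elimRot]
  · have : j ≠ j - 1 := by omega
    simp [elimStep, elimRot, hji, this]

theorem elimStep_d_succ :
    (elimStep F q i j s).d (j + 1) = rotSnd F (elimRot F q j s) (s.β j) (s.d (j + 1)) := by
  simp [elimStep, elimRot]

theorem elimStep_d_of_ne {a : ℕ} (h : a ≠ j) (h' : a ≠ j + 1) :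
    (elimStep F q i j s).d a = s.d a := by
  simp [elimStep, h, h']

theorem elimStep_p_self :
    (elimStep F q i j s).p j = corrected F (conj (q (j + 1)))
      (rotFst F (elimRot F q j s) (s.β j) (s.d (j + 1)))
      (rotSnd F (elimRot F q j s) (s.β j) (s.d (j + 1)))
      (rotFst F (elimRot F q j s) (s.p j) (s.p (j + 1)))
      (rotSnd F (elimRot F q j s) (s.p j) (s.p (j + 1))) := by
  simp [elimStep, elimRot, corrected]

theorem elimStep_p_succ :
    (elimStep F q i j s).p (j + 1) = rotSnd F (elimRot F q j s) (s.p j) (s.p (j + 1)) := by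
  simp [elimStep, elimRot]

theorem elimStep_p_of_ne {a : ℕ} (h : a ≠ j) (h' : a ≠ j + 1) :
    (elimStep F q i j s).p a = s.p a := by
  simp [elimStep, h, h']

theorem elimStep_qt_self :
    (elimStep F q i j s).qt j = rotFst F (elimRot F q j s) (s.qt j) (s.qt (j + 1)) := by
  simp [elimStep, elimRot]

theorem elimStep_qt_of_ne {a : ℕ} (h : a ≠ j) (h' : a ≠ j + 1) :
    (elimStep F q i j s).qt a = s.qt a := by
  simp [elimStep, h, h']

end Step

theorem le_entry_bound {x c u S : ℝ} (h : x ≤ c * u * S) (hc : c ≤ 200) (hu : 0 ≤ u) (hS : 0 ≤ S) :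
    x ≤ 200 * u * S := h.trans (by gcongr)

/-- One elimination step is, up to small relative errors in the columns, a rotation of the rows. -/
theorem elimStep_spec (F : FloatArith u) (hu : u ≤ 1 / 10000) {n i j : ℕ} {q : ℕ → ℂ}
    {s : ElimState} {M : ℕ → ℕ → ℂ} (hij : i ≤ j) (hj : j + 1 < n)
    (h : ElimInv n i (j + 1) q s M) :
    RotClose u (elimRot F q j s) (exactRot u (elimRot F q j s)) ∧
      NearRot (200 * u) n (exactRot u (elimRot F q j s)) j s.p (elimStep F q i j s).p ∧
      ∃ M' : ℕ → ℕ → ℂ, ElimInv n i j q (elimStep F q i j s) M' ∧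
        ∀ b < n, NearRot (200 * u) n (exactRot u (elimRot F q j s)) j (fun a => M a b)
          (fun a => M' a b) := by
  have hu0 := roundoff_nonneg F
  have hz : RotClose u (elimRot F q j s) (exactRot u (elimRot F q j s)) :=
    rotClose_exactRot (mkRot_spec F hu _ _).choose_spec.1
  refine ⟨hz, ?_⟩
  obtain ⟨c1, c2⟩ := corrected_bounds F hu (s.β j) (s.d (j + 1)) (s.p j) (s.p (j + 1))
    (conj (q (j + 1))) (R := elimRot F q j s) rfl hz
  rw [← elimStep_p_self F q i j s] at c1 c2
  have c3 := rotSnd_error F hu hz (s.p j) (s.p (j + 1))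
  rw [← elimStep_p_succ F q i j s] at c3
  have c3' := le_entry_bound c3 (by norm_num) hu0 (by positivity)
  refine ⟨⟨c1, c3', fun a _ => elimStep_p_of_ne F q i j s⟩, ?_⟩
  set R := elimRot F q j s with hR
  set z := exactRot u R
  set s' := elimStep F q i j s with hs'
  -- Entries held by the new state are read off from it. The others in rows `j`, `j + 1` (columns `<
  -- i` and `< j` respectively) are rotated exactly: the invariant says nothing about them, so they
  -- cost no error.
  refine ⟨fun a b =>
    if a = j then
      if j < b then -(s'.p j * conj (q b))
      else if b = j then s'.d j
      else if i ≤ b then if b + 1 = j then s'.γ b else -(s'.qt j * conj (s.p b))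
      else rfst z (M j b) (M (j + 1) b)
    else if a = j + 1 then
      if j + 1 < b then -(s'.p (j + 1) * conj (q b))
      else if b = j + 1 then s'.d (j + 1)
      else if b = j then s'.γ j
      else rsnd z (M j b) (M (j + 1) b)
    else M a b, ⟨?_, ?_, ?_, ?_, ?_⟩, ?_⟩
  · intro a ha
    by_cases h1 : a = j
    · simp [h1]
    by_cases h2 : a = j + 1
    · simp [h2]
    simp only [h1, h2, if_false]
    rw [h.diag a ha, elimStep_d_of_ne F q i j s h1 h2]
  · intro a ha haj
    have h1 : a ≠ j := by omega
    have h2 : a ≠ j + 1 := by omega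
    simp only [h1, h2, if_false]
    rw [h.super a ha (by omega), elimStep_β_of_ne F q i j s h1]
  · intro a b hab hb hc
    by_cases h1 : a = j
    · simp [h1, h1 ▸ hab]
    by_cases h2 : a = j + 1
    · subst h2; simp [hab]
    simp only [h1, h2, if_false]
    rw [h.upper a b hab hb (by omega), elimStep_p_of_ne F q i j s h1 h2]
  · intro a ha han
    by_cases h1 : a + 1 = j
    · have e1 : ¬ j < a := by omega
      have e2 : a ≠ j := by omega
      simp [h1, e1, e2, ha]
    by_cases h2 : a = j
    · simp [h2]
    have h3 : a + 1 ≠ j + 1 := by omega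
    simp only [h1, h3, if_false]
    rw [h.sub a ha han, elimStep_γ_of_ne F q i j s h2 (fun _ => h1) ha hij]
  · intro a b hb hba ha
    have hp : s'.p b = s.p b := elimStep_p_of_ne F q i j s (by omega) (by omega)
    rw [hp]
    by_cases h1 : a = j
    · have e1 : ¬ j < b := by omega
      have e2 : b ≠ j := by omega
      have e3 : b + 1 ≠ j := by omega
      simp [h1, e1, e2, e3, hb]
    have h2 : a ≠ j + 1 := by omega
    simp only [h1, h2, if_false]
    rw [h.lower a b hb hba (by omega), elimStep_qt_of_ne F q i j s h1 h2]
  · intro b hb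
    have hS : 0 ≤ ‖M j b‖ + ‖M (j + 1) b‖ := by positivity
    refine ⟨?_, ?_, fun a _ h1 h2 => by simp [h1, h2]⟩
    · simp only [if_true]
      split_ifs with g1 g2 g3 g4
      · rcases Nat.lt_or_ge (j + 1) b with h1 | h1
        · rw [h.upper j b (by omega) hb (by omega), h.upper (j + 1) b h1 hb (by omega)]
          exact scaled_fst_error _ c1
        -- The critical column: the old entries are `β j` and `d (j + 1)`, but the new entry in row
        -- `j` is generated by the corrected `p j`.
        · have hbj : b = j + 1 := by omega
          subst hbj
          rw [h.super j hij (by omega), h.diag (j + 1) hb]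
          exact c2
      · subst g2
        rw [h.diag b hb, h.sub b hij hj, elimStep_d_self F q i b s hij]
        exact le_entry_bound (rotFst_error F hu hz _ _) (by norm_num) hu0 (by positivity)
      · have e := h.sub b g3 (by omega)
        rw [g4] at e
        rw [e, h.lower (j + 1) b g3 (by omega) le_rfl, elimStep_γ_pred F q i j s g4 g3]
        exact le_entry_bound (rotFst_mul_error F hu hz _ _ _) (by norm_num) hu0 (by positivity)
      · rw [h.lower j b g3 (by omega) (by omega), h.lower (j + 1) b g3 (by omega) le_rfl,
          elimStep_qt_self F q i j s]
        exact scaled_fst_error _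
          (le_entry_bound (rotFst_error F hu hz _ _) (by norm_num) hu0 (by positivity))
      · rw [sub_self, norm_zero]; positivity
    · simp only [Nat.succ_ne_self, if_false, if_true]
      split_ifs with g1 g2 g3
      · rw [h.upper j b (by omega) hb (by omega), h.upper (j + 1) b g1 hb (by omega)]
        exact scaled_snd_error _ c3'
      · subst g2
        rw [h.super j hij (by omega), h.diag (j + 1) hb, elimStep_d_succ F q i j s]
        exact le_entry_bound (rotSnd_error F hu hz _ _) (by norm_num) hu0 (by positivity)
      · subst g3
        rw [h.diag b hb, h.sub b hij hj, elimStep_γ_self F q i b s hij]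
        exact le_entry_bound (rotSnd_error F hu hz _ _) (by norm_num) hu0 (by positivity)
      · rw [sub_self, norm_zero]; positivity

theorem elimLoop_Q_of_le (F : FloatArith u) (q : ℕ → ℂ) (i : ℕ) :
    ∀ (t : ℕ) (s : ElimState) (j : ℕ), i + t ≤ j → (elimLoop F q i t s).Q j = s.Q j
  | 0, _, _, _ => rfl
  | t + 1, s, j, h => by
    rw [elimLoop, elimLoop_Q_of_le F q i t _ j (by omega), elimStep_Q,
      Function.update_of_ne (by omega)]

/-- Accumulation of relative errors under isometries. -/
theorem error_chain {n k l m : ℕ} {X : Matrix (Fin n) (Fin k) ℂ} {Y Z Y' : Matrix (Fin l) (Fin m) ℂ}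
    {r c x : ℝ} (hX : ‖X‖ = x) (hr : 0 ≤ r) (hY : ‖Y - Y'‖ ≤ c * x) (hY' : ‖Y'‖ = x)
    {Z' : Matrix (Fin l) (Fin m) ℂ} (hZ : ‖Z - Z'‖ ≤ r * ‖Y‖) {W : Matrix (Fin l) (Fin m) ℂ}
    (hZW : ‖Z' - W‖ ≤ ‖Y - Y'‖) : ‖Z - W‖ ≤ ((1 + r) * (1 + c) - 1) * ‖X‖ := by
  have hYn : ‖Y‖ ≤ c * x + x := by
    calc ‖Y‖ = ‖(Y - Y') + Y'‖ := by rw [sub_add_cancel]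
      _ ≤ _ := (norm_add_le _ _).trans (by rw [hY']; gcongr)
  calc ‖Z - W‖ = ‖(Z - Z') + (Z' - W)‖ := by rw [sub_add_sub_cancel]
    _ ≤ r * (c * x + x) + c * x := (norm_add_le _ _).trans
        (add_le_add (hZ.trans (by gcongr)) (hZW.trans hY))
    _ = _ := by rw [hX]; ring

/-- `Z ≈ U Y` and `Y ≈ G X` give `Z ≈ U G X`. -/
theorem error_mul {n k : ℕ} {U G : Matrix (Fin n) (Fin n) ℂ} (hU : U ∈ unitaryGroup (Fin n) ℂ)
    (hG : G ∈ unitaryGroup (Fin n) ℂ) {X Y Z : Matrix (Fin n) (Fin k) ℂ} {r c : ℝ} (hr : 0 ≤ r)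
    (hY : ‖Y - G * X‖ ≤ c * ‖X‖) (hZ : ‖Z - U * Y‖ ≤ r * ‖Y‖) :
    ‖Z - U * G * X‖ ≤ ((1 + r) * (1 + c) - 1) * ‖X‖ := by
  refine error_chain rfl hr hY (frobenius_norm_unitary_mul hG X) hZ ?_
  rw [Matrix.mul_assoc, ← Matrix.mul_sub, frobenius_norm_unitary_mul hU]

/-- The exact rotations close to the computed ones. -/
def exactRots (u : ℝ) (Q : ℕ → ℂ × ℂ) : ℕ → ℂ × ℂ := fun j => exactRot u (Q j)

/-- The elimination loop is close to the multiplication by the product of the exact rotations. -/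
theorem elimLoop_spec (F : FloatArith u) (hu : u ≤ 1 / 10000) {n i : ℕ} {q : ℕ → ℂ} :
    ∀ (t : ℕ) (s : ElimState) (M : ℕ → ℕ → ℂ), i + t < n → ElimInv n i (i + t) q s M →
      (∀ j, i ≤ j → j < i + t → RotClose u ((elimLoop F q i t s).Q j)
        (exactRots u (elimLoop F q i t s).Q j)) ∧
      ‖col n (elimLoop F q i t s).p -
          rotProd n (exactRots u (elimLoop F q i t s).Q) i t * col n s.p‖ ≤
        ((1 + 400 * u) ^ t - 1) * ‖col n s.p‖ ∧
      ∃ M' : ℕ → ℕ → ℂ, ElimInv n i i q (elimLoop F q i t s) M' ∧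
        ‖trunc n n M' - rotProd n (exactRots u (elimLoop F q i t s).Q) i t * trunc n n M‖ ≤
          ((1 + 400 * u) ^ t - 1) * ‖trunc n n M‖
  | 0, s, M, _, h => by
    refine ⟨fun j h1 h2 => absurd h2 (by omega), ?_, M, h, ?_⟩ <;> simp [elimLoop, rotProd]
  | t + 1, s, M, hn, h => by
    have hu0 := roundoff_nonneg F
    obtain ⟨hz, hp, M₁, hinv, hM₁⟩ := elimStep_spec F hu (j := i + t) (by omega) (by omega) h
    obtain ⟨hQ, hp', M', hinv', hM'⟩ := elimLoop_spec F hu t _ M₁ (by omega) hinv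
    have hr : 0 ≤ (1 + 400 * u) ^ t - 1 := sub_nonneg.2 (one_le_pow₀ (by linarith))
    -- The remaining steps have smaller indices and leave this pair alone, so the final array
    -- contains every rotation that was used.
    have hQt : (elimLoop F q i (t + 1) s).Q (i + t) = elimRot F q (i + t) s := by
      rw [elimLoop, elimLoop_Q_of_le F q i t _ _ le_rfl, elimStep_Q, Function.update_self]
    have hzt : exactRots u (elimLoop F q i (t + 1) s).Q (i + t) =
        exactRot u (elimRot F q (i + t) s) := by rw [exactRots, hQt]
    have hUt : rotProd n (exactRots u (elimLoop F q i (t + 1) s).Q) i t ∈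
        unitaryGroup (Fin n) ℂ := rotProd_mem_unitaryGroup (fun _ => isRot_exactRot _ _) (by omega)
    have hG : givens n (i + t) (exactRot u (elimRot F q (i + t) s)) ∈ unitaryGroup (Fin n) ℂ :=
      givens_mem_unitaryGroup (by omega) (isRot_exactRot _ _)
    have hc : (1 + 400 * u) ^ (t + 1) - 1 =
        (1 + ((1 + 400 * u) ^ t - 1)) * (1 + 2 * (200 * u)) - 1 := by ring
    refine ⟨fun j h1 h2 => ?_, ?_, M', hinv', ?_⟩
    · rcases Nat.lt_or_ge j (i + t) with h3 | h3
      · exact hQ j h1 h3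
      · obtain rfl : j = i + t := by omega
        rw [hzt, hQt]; exact hz
    · rw [rotProd, hzt, hc]
      exact error_mul hUt hG hr
        (norm_sub_givens_mul_le (by omega) (by positivity) fun _ _ => hp) hp'
    · rw [rotProd, hzt, hc]
      exact error_mul hUt hG hr
        (norm_sub_givens_mul_le (by omega) (by positivity) hM₁) hM'

end Elim

/-! ### The rotation back to Hessenberg form -/

section Back

variable {u : ℝ}

/-- The variables of the rotation back, after the columns `≥ J` have been completed, describe the
matrix `M`. -/
structure BackInv (n i J : ℕ) (γ p : ℕ → ℂ) (s : BackState) (M : ℕ → ℕ → ℂ) : Prop where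
  diag : ∀ a < n, M a a = s.d a
  super : ∀ a, J ≤ a → a + 1 < n → M a (a + 1) = s.β a
  upper : ∀ a b, a < b → b < n → (a + 1 < b ∨ a < J) → M a b = -(p a * conj (s.q b))
  -- Entry `(a + 1, a)` is needed once, in step `a`, for the new `d (a + 1)`; nothing else below the
  -- diagonal enters.
  sub : ∀ a, i ≤ a → a < J → M (a + 1) a = γ a

theorem conj_rfst (z : ℂ × ℂ) (x y : ℂ) :
    conj (rfst z x y) = rfst (conj z.1, conj z.2) (conj x) (conj y) := by
  simp [rfst]

theorem conj_rsnd (z : ℂ × ℂ) (x y : ℂ) :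
    conj (rsnd z x y) = rsnd (conj z.1, conj z.2) (conj x) (conj y) := by
  simp [rsnd]

theorem scaled_conj_fst_error {c : ℝ} {z : ℂ × ℂ} {x x₀ x₁ : ℂ} (y : ℂ)
    (h : ‖x - rfst z x₀ x₁‖ ≤ c * (‖x₀‖ + ‖x₁‖)) :
    ‖-(y * conj x) - rfst (conj z.1, conj z.2) (-(y * conj x₀)) (-(y * conj x₁))‖ ≤
      c * (‖-(y * conj x₀)‖ + ‖-(y * conj x₁)‖) := by
  rw [mul_comm y, mul_comm y, mul_comm y]
  refine scaled_fst_error y ?_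
  rw [← conj_rfst, ← map_sub]
  simpa only [RCLike.norm_conj] using h

theorem scaled_conj_snd_error {c : ℝ} {z : ℂ × ℂ} {x x₀ x₁ : ℂ} (y : ℂ)
    (h : ‖x - rsnd z x₀ x₁‖ ≤ c * (‖x₀‖ + ‖x₁‖)) :
    ‖-(y * conj x) - rsnd (conj z.1, conj z.2) (-(y * conj x₀)) (-(y * conj x₁))‖ ≤
      c * (‖-(y * conj x₀)‖ + ‖-(y * conj x₁)‖) := by
  rw [mul_comm y, mul_comm y, mul_comm y]
  refine scaled_snd_error y ?_
  rw [← conj_rsnd, ← map_sub]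
  simpa only [RCLike.norm_conj] using h

/-- One step of the rotation back is, up to small relative errors in the rows, a rotation of the
columns. -/
theorem backStep_spec (F : FloatArith u) (hu : u ≤ 1 / 10000) {n i j : ℕ} {γ p : ℕ → ℂ}
    {Q : ℕ → ℂ × ℂ} {s : BackState} {M : ℕ → ℕ → ℂ} {z : ℂ × ℂ} (hz : RotClose u (Q j) z)
    (hij : i ≤ j) (hj : j + 1 < n) (h : BackInv n i (j + 1) γ p s M) :
    NearRot (200 * u) n z j s.q (backStep F γ p Q j s).q ∧
      ∃ M' : ℕ → ℕ → ℂ, BackInv n i j γ p (backStep F γ p Q j s) M' ∧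
        ∀ a < n, NearRot (200 * u) n (conj z.1, conj z.2) j (M a) (M' a) := by
  have hu0 := roundoff_nonneg F
  have hzc := hz.conj
  have dself : (backStep F γ p Q j s).d j =
      rotFst F (conjRot (Q j)) (s.d j) (-(F.mul (p j) (conj (s.q (j + 1))))) := by
    simp [backStep]
  have dsucc : (backStep F γ p Q j s).d (j + 1) =
      rotSnd F (conjRot (Q j)) (γ j) (s.d (j + 1)) := by simp [backStep]
  have dne : ∀ a, a ≠ j → a ≠ j + 1 → (backStep F γ p Q j s).d a = s.d a := by
    intro a h1 h2; simp [backStep, h1, h2]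
  have βself : (backStep F γ p Q j s).β j =
      rotSnd F (conjRot (Q j)) (s.d j) (-(F.mul (p j) (conj (s.q (j + 1))))) := by
    simp [backStep]
  have βne : ∀ a, a ≠ j → (backStep F γ p Q j s).β a = s.β a := by
    intro a h1; simp [backStep, h1]
  have qself : (backStep F γ p Q j s).q j = rotFst F (Q j) (s.q j) (s.q (j + 1)) := by
    simp [backStep]
  have qsucc : (backStep F γ p Q j s).q (j + 1) = rotSnd F (Q j) (s.q j) (s.q (j + 1)) := by
    simp [backStep]
  have qne : ∀ a, a ≠ j → a ≠ j + 1 → (backStep F γ p Q j s).q a = s.q a := by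
    intro a h1 h2; simp [backStep, h1, h2]
  have q1 := le_entry_bound (rotFst_error F hu hz (s.q j) (s.q (j + 1))) (by norm_num) hu0
    (by positivity)
  have q2 := le_entry_bound (rotSnd_error F hu hz (s.q j) (s.q (j + 1))) (by norm_num) hu0
    (by positivity)
  rw [← qself] at q1
  rw [← qsucc] at q2
  refine ⟨⟨q1, q2, fun a _ => qne a⟩, ?_⟩
  set s' := backStep F γ p Q j s
  set w : ℂ × ℂ := (conj z.1, conj z.2) with hw
  -- Below the diagonal the columns are rotated exactly, without error; that part is later replaced
  -- by the conjugate of the upper triangle.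
  refine ⟨fun a b =>
    if b = j then
      if a < j then -(p a * conj (s'.q j))
      else if a = j then s'.d j
      else rfst w (M a j) (M a (j + 1))
    else if b = j + 1 then
      if a < j then -(p a * conj (s'.q (j + 1)))
      else if a = j then s'.β j
      else if a = j + 1 then s'.d (j + 1)
      else rsnd w (M a j) (M a (j + 1))
    else M a b, ⟨?_, ?_, ?_, ?_⟩, ?_⟩
  · intro a ha
    by_cases h1 : a = j
    · simp [h1]
    by_cases h2 : a = j + 1
    · simp [h2]
    simp only [h1, h2, if_false]
    rw [h.diag a ha, dne a h1 h2]
  · intro a haj han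
    by_cases h1 : a = j
    · simp [h1]
    have h2 : a + 1 ≠ j := by omega
    have h3 : a + 1 ≠ j + 1 := by omega
    simp only [h2, h3, if_false]
    rw [h.super a (by omega) han, βne a h1]
  · intro a b hab hb hc
    by_cases h1 : b = j
    · have : a < j := by omega
      simp [h1, this]
    by_cases h2 : b = j + 1
    · have : a < j := by omega
      simp [h2, this]
    simp only [h1, h2, if_false]
    rw [h.upper a b hab hb (by omega), qne b h1 h2]
  · intro a hia haj
    have h1 : a ≠ j := by omega
    have h2 : a ≠ j + 1 := by omega
    simp only [h1, h2, if_false]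
    exact h.sub a hia (by omega)
  · intro a ha
    have hS : 0 ≤ ‖M a j‖ + ‖M a (j + 1)‖ := by positivity
    refine ⟨?_, ?_, fun b _ h1 h2 => by simp [h1, h2]⟩
    · simp only [if_true]
      split_ifs with g1 g2
      · rw [h.upper a j g1 (by omega) (by omega), h.upper a (j + 1) (by omega) hj (by omega)]
        exact scaled_conj_fst_error _ q1
      · subst g2
        rw [h.diag a ha, h.upper a (a + 1) (by omega) hj (by omega), dself]
        exact le_entry_bound (rotFst_mul_error F hu hzc _ _ _) (by norm_num) hu0 (by positivity)
      · rw [sub_self, norm_zero]; positivity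
    · simp only [Nat.succ_ne_self, if_false, if_true]
      split_ifs with g1 g2 g3
      · rw [h.upper a j g1 (by omega) (by omega), h.upper a (j + 1) (by omega) hj (by omega)]
        exact scaled_conj_snd_error _ q2
      · subst g2
        rw [h.diag a ha, h.upper a (a + 1) (by omega) hj (by omega), βself]
        exact le_entry_bound (rotSnd_mul_error F hu hzc _ _ _) (by norm_num) hu0 (by positivity)
      · subst g3
        rw [h.diag (j + 1) ha, h.sub j hij (by omega), dsucc]
        exact le_entry_bound (rotSnd_error F hu hzc _ _) (by norm_num) hu0 (by positivity)
      · rw [sub_self, norm_zero]; positivity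

/-- `Z ≈ Y U*` and `Y ≈ X G*` give `Z ≈ X (U G)*`. -/
theorem error_mul_conjTranspose {n k : ℕ} {U G : Matrix (Fin n) (Fin n) ℂ}
    (hU : U ∈ unitaryGroup (Fin n) ℂ) (hG : G ∈ unitaryGroup (Fin n) ℂ)
    {X Y Z : Matrix (Fin k) (Fin n) ℂ} {r c : ℝ} (hr : 0 ≤ r)
    (hY : ‖Y - X * Gᴴ‖ ≤ c * ‖X‖) (hZ : ‖Z - Y * Uᴴ‖ ≤ r * ‖Y‖) :
    ‖Z - X * (U * G)ᴴ‖ ≤ ((1 + r) * (1 + c) - 1) * ‖X‖ := by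
  refine error_chain rfl hr hY (frobenius_norm_mul_conjTranspose_unitary hG X) hZ ?_
  rw [conjTranspose_mul, ← Matrix.mul_assoc, ← Matrix.sub_mul,
    frobenius_norm_mul_conjTranspose_unitary hU]

theorem backLoop_spec (F : FloatArith u) (hu : u ≤ 1 / 10000) {n i : ℕ} {γ p : ℕ → ℂ}
    {Q : ℕ → ℂ × ℂ} :
    ∀ (t : ℕ) (s : BackState) (M : ℕ → ℕ → ℂ), i + t < n → BackInv n i (i + t) γ p s M →
      (∀ j, i ≤ j → j < i + t → RotClose u (Q j) (exactRots u Q j)) →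
      ‖col n (backLoop F γ p Q i t s).q - rotProd n (exactRots u Q) i t * col n s.q‖ ≤
        ((1 + 400 * u) ^ t - 1) * ‖col n s.q‖ ∧
      ∃ M' : ℕ → ℕ → ℂ, BackInv n i i γ p (backLoop F γ p Q i t s) M' ∧
        ‖trunc n n M' - trunc n n M * (rotProd n (exactRots u Q) i t)ᴴ‖ ≤
          ((1 + 400 * u) ^ t - 1) * ‖trunc n n M‖
  | 0, s, M, _, h, _ => by
    refine ⟨?_, M, h, ?_⟩ <;> simp [backLoop, rotProd]
  | t + 1, s, M, hn, h, hQ => by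
    have hu0 := roundoff_nonneg F
    obtain ⟨hq, M₁, hinv, hM₁⟩ := backStep_spec F hu (j := i + t)
      (hQ (i + t) (by omega) (by omega)) (by omega) (by omega) h
    obtain ⟨hq', M', hinv', hM'⟩ := backLoop_spec F hu t _ M₁ (by omega) hinv
      fun j h1 h2 => hQ j h1 (by omega)
    have hr : 0 ≤ (1 + 400 * u) ^ t - 1 := sub_nonneg.2 (one_le_pow₀ (by linarith))
    have hUt : rotProd n (exactRots u Q) i t ∈ unitaryGroup (Fin n) ℂ :=
      rotProd_mem_unitaryGroup (fun _ => isRot_exactRot _ _) (by omega)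
    have hG : givens n (i + t) (exactRots u Q (i + t)) ∈ unitaryGroup (Fin n) ℂ :=
      givens_mem_unitaryGroup (by omega) (isRot_exactRot _ _)
    have hc : (1 + 400 * u) ^ (t + 1) - 1 =
        (1 + ((1 + 400 * u) ^ t - 1)) * (1 + 2 * (200 * u)) - 1 := by ring
    refine ⟨?_, M', hinv', ?_⟩
    · rw [rotProd, hc]
      exact error_mul hUt hG hr
        (norm_sub_givens_mul_le (by omega) (by positivity) fun _ _ => hq) hq'
    · rw [rotProd, hc]
      exact error_mul_conjTranspose hUt hG hr
        (norm_sub_mul_givens_le (by omega) (by positivity) hM₁) hM'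

end Back

/-! ### One QR iteration -/

section Sweep

variable {u : ℝ}

/-- The entries above the diagonal described by the generators, when the superdiagonal entries in
the rows `< i` have been deflated. -/
def upperEntry (i : ℕ) (g : Generators) (a b : ℕ) : ℂ :=
  if a + 1 = b ∧ i ≤ a then g.β a else -(g.p a * conj (g.q b))

/-- The matrix described by the generators: Hermitian apart from the diagonal, which need not be
real. -/
def genMatrix (i : ℕ) (g : Generators) (a b : ℕ) : ℂ :=
  if a = b then g.d a else if a < b then upperEntry i g a b else conj (upperEntry i g b a)

theorem genMatrix_conj {i : ℕ} {g : Generators} {a b : ℕ} (h : a ≠ b) :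
    genMatrix i g a b = conj (genMatrix i g b a) := by
  unfold genMatrix
  rcases Nat.lt_or_gt_of_ne h with h1 | h1
  · have : ¬ b < a := by omega
    simp [h, h.symm, h1, this]
  · have : ¬ a < b := by omega
    simp [h, h.symm, h1, this]

theorem elimInv_genMatrix {n i : ℕ} (g : Generators) (Q : ℕ → ℂ × ℂ) (hi : i + 1 ≤ n) :
    ElimInv n i (i + (n - 1 - i)) g.q
      { d := g.d, γ := fun j => conj (g.β j), β := g.β, p := g.p, qt := g.q, Q := Q }
      (genMatrix i g) where
  diag a _ := by simp [genMatrix]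
  super a h1 _ := by simp [genMatrix, upperEntry, h1]
  upper a b h1 h2 h3 := by
    have e : ¬ (a + 1 = b ∧ i ≤ a) := by omega
    simp [genMatrix, upperEntry, h1.ne, h1, e]
  sub a h1 _ := by simp [genMatrix, upperEntry, h1]
  lower a b h1 h2 _ := by
    have e1 : a ≠ b := by omega
    have e2 : ¬ a < b := by omega
    have e3 : ¬ (b + 1 = a ∧ i ≤ b) := by omega
    simp [genMatrix, upperEntry, e1, e2, e3, mul_comm]

/-- One QR iteration is close to an exact unitary similarity. -/
theorem sweep_spec (F : FloatArith u) (hu : u ≤ 1 / 10000) {n i : ℕ} (hi : i + 1 ≤ n)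
    (g : Generators) : ∃ U ∈ unitaryGroup (Fin n) ℂ,
      ‖col n (sweep F n i g).p - U * col n g.p‖ ≤ ((1 + 400 * u) ^ (2 * n) - 1) * ‖col n g.p‖ ∧
      ‖col n (sweep F n i g).q - U * col n g.q‖ ≤ ((1 + 400 * u) ^ (2 * n) - 1) * ‖col n g.q‖ ∧
      ∃ M : ℕ → ℕ → ℂ, (∀ a b, a ≤ b → b < n → M a b = genMatrix i (sweep F n i g) a b) ∧
        ‖trunc n n M - U * trunc n n (genMatrix i g) * Uᴴ‖ ≤
          ((1 + 400 * u) ^ (2 * n) - 1) * ‖trunc n n (genMatrix i g)‖ := by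
  have hu0 := roundoff_nonneg F
  obtain ⟨hQ, hp, M₁, hinv, hM₁⟩ := elimLoop_spec F hu (n - 1 - i) _ _ (by omega)
    (elimInv_genMatrix (n := n) (i := i) g (fun _ => (1, 0)) hi)
  set e := elimLoop F g.q i (n - 1 - i)
    { d := g.d, γ := fun j => conj (g.β j), β := g.β, p := g.p, qt := g.q, Q := fun _ => (1, 0) }
  -- Here `J = n - 1`: no column is completed, so `super` is vacuous, and after the elimination the
  -- superdiagonal is also generated by `p` and `q`.
  have hback : BackInv n i (i + (n - 1 - i)) e.γ e.p { d := e.d, β := g.β, q := g.q } M₁ :=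
    { diag := hinv.diag
      super := fun a h1 h2 => absurd h2 (by omega)
      upper := fun a b h1 h2 _ => hinv.upper a b h1 h2 (by omega)
      sub := fun a h1 h2 => hinv.sub a h1 (by omega) }
  obtain ⟨hq, M₂, hinv₂, hM₂⟩ := backLoop_spec F hu (n - 1 - i) _ _ (by omega) hback hQ
  set b := backLoop F e.γ e.p e.Q i (n - 1 - i) { d := e.d, β := g.β, q := g.q }
  have hg : sweep F n i g = { d := b.d, β := b.β, p := e.p, q := b.q } := rfl
  set U := rotProd n (exactRots u e.Q) i (n - 1 - i)
  have hU : U ∈ unitaryGroup (Fin n) ℂ :=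
    rotProd_mem_unitaryGroup (fun _ => isRot_exactRot _ _) (by omega)
  have h1 : (1 : ℝ) ≤ 1 + 400 * u := by linarith
  have hr : 0 ≤ (1 + 400 * u) ^ (n - 1 - i) - 1 := sub_nonneg.2 (one_le_pow₀ h1)
  have hle : (1 + 400 * u) ^ (n - 1 - i) ≤ (1 + 400 * u) ^ (2 * n) :=
    pow_le_pow_right₀ h1 (by omega)
  have hle2 : (1 + ((1 + 400 * u) ^ (n - 1 - i) - 1)) * (1 + ((1 + 400 * u) ^ (n - 1 - i) - 1)) ≤
      (1 + 400 * u) ^ (2 * n) := by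
    rw [add_sub_cancel, ← pow_add]
    exact pow_le_pow_right₀ h1 (by omega)
  rw [hg]
  refine ⟨U, hU, hp.trans (by gcongr), hq.trans (by gcongr), M₂, ?_, ?_⟩
  · intro x y hxy hy
    rcases hxy.eq_or_lt with h | h
    · subst h; rw [hinv₂.diag x hy]; simp [genMatrix]
    · simp only [genMatrix, upperEntry, h.ne, h, if_true, if_false]
      split_ifs with h2
      · obtain ⟨rfl, h3⟩ := h2
        exact hinv₂.super x h3 hy
      · exact hinv₂.upper x y h hy (by omega)
  · refine (error_chain rfl hr hM₁ (frobenius_norm_unitary_mul hU _) hM₂ ?_).trans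
      (by gcongr)
    rw [← Matrix.sub_mul, frobenius_norm_mul_conjTranspose_unitary hU]

/-- Below the diagonal `(N - W) a b = conj ((M - W) b a) - (W - Wᴴ) a b`: the error of the upper
triangle is reflected, and the Hermitian defect of `W` is added. The defect of `N` itself lives on
the diagonal, where `N` is `M`. -/
theorem sub_conjTranspose_completion {n : ℕ} {N M W : Matrix (Fin n) (Fin n) ℂ}
    (hup : ∀ a b, a ≤ b → N a b = M a b) (hlow : ∀ a b, a ≠ b → N a b = conj (N b a)) :
    ‖N - W‖ ≤ 2 * ‖M - W‖ + ‖W - Wᴴ‖ ∧ ‖N - Nᴴ‖ ≤ 2 * ‖M - W‖ + ‖W - Wᴴ‖ := by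
  have e : 2 * ‖M - W‖ + ‖W - Wᴴ‖ = ‖M - W‖ + ‖(M - W)ᴴ‖ + ‖W - Wᴴ‖ := by
    rw [frobenius_norm_conjTranspose]; ring
  rw [e]
  constructor
  · refine frobenius_norm_le_of_le_add fun a b => ?_
    rcases le_or_gt a b with h | h
    · rw [Matrix.sub_apply, hup a b h, ← Matrix.sub_apply]
      have := norm_nonneg ((M - W)ᴴ a b)
      have := norm_nonneg ((W - Wᴴ) a b)
      linarith
    · have : (N - W) a b = (M - W)ᴴ a b - (W - Wᴴ) a b := by
        simp only [Matrix.sub_apply, conjTranspose_apply, star_sub]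
        rw [hlow a b h.ne', hup b a h.le]
        simp
      rw [this]
      have := norm_sub_le ((M - W)ᴴ a b) ((W - Wᴴ) a b)
      have := norm_nonneg ((M - W) a b)
      linarith
  · refine frobenius_norm_le_of_le_add fun a b => ?_
    by_cases h : a = b
    · subst h
      have : (N - Nᴴ) a a = (M - W) a a - (M - W)ᴴ a a + (W - Wᴴ) a a := by
        simp only [Matrix.sub_apply, conjTranspose_apply, star_sub]
        rw [hup a a le_rfl]
        ring
      rw [this]
      exact (norm_add_le _ _).trans (by gcongr; exact norm_sub_le _ _)
    · have : (N - Nᴴ) a b = 0 := by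
        simp only [Matrix.sub_apply, conjTranspose_apply]
        rw [hlow a b h]
        simp
      rw [this, norm_zero]
      positivity

end Sweep

/-! ### Accumulation of the errors -/

section Global

variable {u : ℝ}

/-- Up to the errors `e` and `r`, the generators describe a unitary transform of `A`, `P`, `Q`;
the matrix they describe is Hermitian up to `s`. -/
def Tracked {n : ℕ} (A : Matrix (Fin n) (Fin n) ℂ) (P Q : Matrix (Fin n) (Fin 1) ℂ) (i : ℕ)
    (g : Generators) (e s r : ℝ) : Prop :=
  ∃ V ∈ unitaryGroup (Fin n) ℂ,
    ‖trunc n n (genMatrix i g) - V * A * Vᴴ‖ ≤ e ∧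
    ‖trunc n n (genMatrix i g) - (trunc n n (genMatrix i g))ᴴ‖ ≤ s ∧
    ‖col n g.p - V * P‖ ≤ r * ‖P‖ ∧ ‖col n g.q - V * Q‖ ≤ r * ‖Q‖

variable {n i : ℕ} {A : Matrix (Fin n) (Fin n) ℂ} {P Q : Matrix (Fin n) (Fin 1) ℂ}
  {g : Generators} {e s r : ℝ}

theorem Tracked.mono {e' : ℝ} (h : Tracked A P Q i g e s r) (he : e ≤ e') :
    Tracked A P Q i g e' s r := by
  obtain ⟨V, hV, h1, h2⟩ := h
  exact ⟨V, hV, h1.trans he, h2⟩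

theorem norm_le_of_near_conj {X V : Matrix (Fin n) (Fin n) ℂ} (hV : V ∈ unitaryGroup (Fin n) ℂ)
    (h : ‖X - V * A * Vᴴ‖ ≤ e) (he : e ≤ ‖A‖) : ‖X‖ ≤ 2 * ‖A‖ := by
  calc ‖X‖ = ‖(X - V * A * Vᴴ) + V * A * Vᴴ‖ := by rw [sub_add_cancel]
    _ ≤ e + ‖A‖ := (norm_add_le _ _).trans
        (add_le_add h (frobenius_norm_conj_unitary hV A).le)
    _ ≤ _ := by linarith

/-- Since `e ≤ ‖A‖`, the described matrix has norm at most `2‖A‖`, so one iteration errs by `2η‖A‖`.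
Completion by conjugation doubles this and adds the old defect `s` to the error. -/
theorem Tracked.sweep (F : FloatArith u) (hu : u ≤ 1 / 10000) (hi : i + 1 ≤ n)
    (h : Tracked A P Q i g e s r) (he : e ≤ ‖A‖) {η : ℝ} (hη : η = (1 + 400 * u) ^ (2 * n) - 1) :
    Tracked A P Q i (sweep F n i g) (e + s + 4 * η * ‖A‖) (s + 4 * η * ‖A‖)
      ((1 + η) * (1 + r) - 1) := by
  have hu0 := roundoff_nonneg F
  have hη0 : 0 ≤ η := by rw [hη]; exact sub_nonneg.2 (one_le_pow₀ (by linarith))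
  obtain ⟨V, hV, h1, h2, h3, h4⟩ := h
  obtain ⟨U, hU, hp, hq, M, hup, hM⟩ := sweep_spec F hu hi g
  rw [← hη] at hp hq hM
  have hX := norm_le_of_near_conj hV h1 he
  set X := trunc n n (genMatrix i g)
  set N := trunc n n (genMatrix i (StructuredQR.sweep F n i g))
  set W := U * X * Uᴴ
  have hMW : ‖trunc n n M - W‖ ≤ 2 * η * ‖A‖ := hM.trans (by nlinarith)
  have hW : ‖W - Wᴴ‖ ≤ s := by
    have : W - Wᴴ = U * (X - Xᴴ) * Uᴴ := by
      simp only [W, conjTranspose_mul, conjTranspose_conjTranspose, Matrix.mul_sub, Matrix.sub_mul,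
        Matrix.mul_assoc]
    rw [this, frobenius_norm_conj_unitary hU]
    exact h2
  obtain ⟨k1, k2⟩ := sub_conjTranspose_completion (N := N) (M := trunc n n M) (W := W)
    (fun a b hab => (hup a b hab b.2).symm)
    (fun a b hab => genMatrix_conj (fun h => hab (Fin.ext h)))
  refine ⟨U * V, mul_mem hU hV, ?_, by linarith, error_mul hU hV hη0 h3 hp,
    error_mul hU hV hη0 h4 hq⟩
  have e1 : W - U * V * A * (U * V)ᴴ = U * (X - V * A * Vᴴ) * Uᴴ := by
    simp only [W, conjTranspose_mul, Matrix.mul_sub, Matrix.sub_mul, Matrix.mul_assoc]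
  have e2 : ‖W - U * V * A * (U * V)ᴴ‖ ≤ e := by
    rw [e1, frobenius_norm_conj_unitary hU]
    exact h1
  calc _ = ‖(N - W) + (W - U * V * A * (U * V)ᴴ)‖ := by rw [sub_add_sub_cancel]
    _ ≤ _ := norm_add_le _ _
    _ ≤ _ := by linarith

/-- A superdiagonal entry that passes the deflation test is small. -/
theorem norm_superdiag_le (F : FloatArith u) (hu : u ≤ 1 / 10000) {ε : ℝ} (hε : 0 ≤ ε)
    (h : superdiagAbs F i g < ε) :
    ‖g.β i + g.p i * conj (g.q (i + 1))‖ ≤ 2 * ε + 7 * u * ‖g.β i‖ := by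
  have hu0 := roundoff_nonneg F
  have hf := fused_error F hu (g.β i) (g.p i) (conj (g.q (i + 1)))
  unfold superdiagAbs at h
  generalize F.add (g.β i) (F.mul (g.p i) (conj (g.q (i + 1)))) = x at *
  generalize g.p i * conj (g.q (i + 1)) = w at *
  generalize g.β i = β at *
  obtain ⟨b1, b2⟩ := absSq_bounds F x
  have hx := norm_nonneg x
  have hs := sqrt_bounds F hu hx
    (le_trans (by gcongr; nlinarith) b1) (b2.trans (by gcongr; nlinarith))
  have hxε : ‖x‖ ≤ 1001 / 1000 * ε := by
    have := (abs_le.1 hs).1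
    have : u * ‖x‖ ≤ 1 / 10000 * ‖x‖ := by gcongr
    linarith
  have hw : ‖w‖ ≤ ‖β + w‖ + ‖β‖ := by
    calc ‖w‖ = ‖(β + w) - β‖ := by rw [add_sub_cancel_left]
      _ ≤ _ := norm_sub_le _ _
  have hX : ‖β + w‖ ≤ ‖x‖ + ‖x - (β + w)‖ := by
    calc ‖β + w‖ = ‖x - (x - (β + w))‖ := by rw [sub_sub_cancel]
      _ ≤ _ := norm_sub_le _ _
  have h0 := norm_nonneg (β + w)
  have hβ := mul_nonneg hu0 (norm_nonneg β)
  have k1 : u * ‖w‖ ≤ u * (‖β + w‖ + ‖β‖) := by gcongr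
  have k2 : u * ‖β + w‖ ≤ 1 / 10000 * ‖β + w‖ := by gcongr
  linarith

theorem norm_genMatrix_succ_sub_le (hi : i + 1 < n) :
    ‖trunc n n (genMatrix (i + 1) g) - trunc n n (genMatrix i g)‖ ≤
      2 * ‖g.β i + g.p i * conj (g.q (i + 1))‖ := by
  set x := g.β i + g.p i * conj (g.q (i + 1)) with hx
  have e : 2 * ‖x‖ = ‖Matrix.single (⟨i, by omega⟩ : Fin n) (⟨i + 1, hi⟩ : Fin n) x‖ +
      ‖Matrix.single (⟨i + 1, hi⟩ : Fin n) (⟨i, by omega⟩ : Fin n) x‖ +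
      ‖(0 : Matrix (Fin n) (Fin n) ℂ)‖ := by
    rw [frobenius_norm_single, frobenius_norm_single, norm_zero]; ring
  rw [e]
  have hup : ∀ a b, ¬ (a = i ∧ b = i + 1) → upperEntry (i + 1) g a b = upperEntry i g a b := by
    intro a b h
    unfold upperEntry
    by_cases h1 : a + 1 = b ∧ i ≤ a
    · rw [if_pos h1, if_pos ⟨h1.1, by omega⟩]
    · rw [if_neg h1, if_neg (by omega)]
  have hxe : upperEntry (i + 1) g i (i + 1) - upperEntry i g i (i + 1) = -x := by
    simp [upperEntry, hx]; ring
  refine frobenius_norm_le_of_le_add ?_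
  rintro ⟨a, ha⟩ ⟨b, hb⟩
  simp only [Matrix.sub_apply, trunc, genMatrix, Matrix.single_apply, Fin.mk.injEq]
  by_cases h1 : a = i ∧ b = i + 1
  · obtain ⟨rfl, rfl⟩ := h1
    simp [hxe]
  by_cases h2 : b = i ∧ a = i + 1
  · obtain ⟨rfl, rfl⟩ := h2
    simp [← map_sub, hxe]
  rw [hup a b h1, hup b a h2, sub_self, norm_zero]
  positivity

theorem genMatrix_sub_conj (i i' : ℕ) (g : Generators) (a b : ℕ) :
    genMatrix i g a b - conj (genMatrix i g b a) =
      genMatrix i' g a b - conj (genMatrix i' g b a) := by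
  by_cases h : a = b
  · subst h; simp [genMatrix]
  · rw [genMatrix_conj h, genMatrix_conj (i := i') h]; simp

/-- Two entries change by at most `2ε + 7u · 2‖A‖` each. The defect `s` is unaffected: it sits on
the diagonal, which deflation does not touch. -/
theorem Tracked.deflate (F : FloatArith u) (hu : u ≤ 1 / 10000) {ε : ℝ} (hε : 0 ≤ ε)
    (hi : i + 1 < n) (h : Tracked A P Q i g e s r) (he : e ≤ ‖A‖) (ht : superdiagAbs F i g < ε) :
    Tracked A P Q (i + 1) g (e + (4 * ε + 28 * u * ‖A‖)) s r := by
  have hu0 := roundoff_nonneg F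
  obtain ⟨V, hV, h1, h2, h3⟩ := h
  have hX := norm_le_of_near_conj hV h1 he
  have hβ : ‖g.β i‖ ≤ 2 * ‖A‖ := by
    have := norm_apply_le_frobenius (trunc n n (genMatrix i g)) ⟨i, by omega⟩ ⟨i + 1, hi⟩
    simp only [trunc, genMatrix, upperEntry] at this
    simp at this
    exact this.trans hX
  have hx := norm_superdiag_le F hu hε ht
  have hd := norm_genMatrix_succ_sub_le (g := g) hi
  refine ⟨V, hV, ?_, ?_, h3⟩
  · have : u * ‖g.β i‖ ≤ u * (2 * ‖A‖) := by gcongr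
    have t := norm_sub_le_norm_sub_add_norm_sub (trunc n n (genMatrix (i + 1) g))
      (trunc n n (genMatrix i g)) (V * A * Vᴴ)
    linarith
  · have : trunc n n (genMatrix (i + 1) g) - (trunc n n (genMatrix (i + 1) g))ᴴ =
        trunc n n (genMatrix i g) - (trunc n n (genMatrix i g))ᴴ := by
      ext a b
      exact genMatrix_sub_conj (i + 1) i g a b
    rw [this]
    exact h2

variable {θ D η ε : ℝ}

/-- The recursion `e ← e + s + θ`, `s ← s + θ` is dominated by `e = k²θ`, `s = kθ`, because `k² + k
+ 1 ≤ (k + 1)²` for `k ≥ 0`. Here `k` counts the iterations already done. The budget hypothesis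
bounds the final total and thereby keeps `e ≤ ‖A‖` throughout. -/
theorem WhileLoop.tracked (F : FloatArith u) (hu : u ≤ 1 / 10000) (hε : 0 ≤ ε) (hi : i + 1 < n)
    (hη : η = (1 + 400 * u) ^ (2 * n) - 1) (hθ : θ = 4 * η * ‖A‖)
    (hD : D = 4 * ε + 28 * u * ‖A‖) {m : ℕ} {g' : Generators} (hw : WhileLoop F n ε i g m g') :
    ∀ k : ℕ, ((k + m : ℕ) : ℝ) ^ 2 * θ + n * D ≤ ‖A‖ →
      Tracked A P Q i g ((k : ℝ) ^ 2 * θ + i * D) (k * θ) ((1 + η) ^ k - 1) →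
      Tracked A P Q (i + 1) g' (((k + m : ℕ) : ℝ) ^ 2 * θ + (i + 1 : ℕ) * D) ((k + m : ℕ) * θ)
        ((1 + η) ^ (k + m) - 1) := by
  have hu0 := roundoff_nonneg F
  have hη0 : 0 ≤ η := by rw [hη]; exact sub_nonneg.2 (one_le_pow₀ (by linarith))
  have hθ0 : 0 ≤ θ := by rw [hθ]; positivity
  have hD0 : 0 ≤ D := by rw [hD]; positivity
  have hiD : (i : ℝ) * D ≤ n * D := by
    have : (i : ℝ) ≤ n := by exact_mod_cast (by omega : i ≤ n)
    gcongr
  induction hw with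
  | exit g ht =>
    intro k hk h
    have := h.deflate F hu hε hi (le_trans (by simpa using hiD) hk) ht
    rw [← hD] at this
    refine Tracked.mono this (le_of_eq ?_)
    push_cast; ring
  | step g g' m _ _ ih =>
    intro k hk h
    have hkm : (k : ℝ) ^ 2 * θ ≤ ((k + (m + 1) : ℕ) : ℝ) ^ 2 * θ := by
      gcongr; omega
    have h' := h.sweep F hu hi.le (by linarith) hη
    rw [← hθ] at h'
    have e1 : k + (m + 1) = k + 1 + m := by ring
    rw [e1] at hk ⊢
    refine ih (k + 1) hk ?_
    have e2 : (k : ℝ) * θ + θ = ((k + 1 : ℕ) : ℝ) * θ := by push_cast; ring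
    have e3 : (1 + η) * (1 + ((1 + η) ^ k - 1)) - 1 = (1 + η) ^ (k + 1) - 1 := by ring
    rw [e2, e3] at h'
    refine h'.mono ?_
    push_cast
    nlinarith [mul_nonneg (Nat.cast_nonneg (α := ℝ) k) hθ0]

theorem ForLoop.tracked (F : FloatArith u) (hu : u ≤ 1 / 10000) (hε : 0 ≤ ε)
    (hη : η = (1 + 400 * u) ^ (2 * n) - 1) (hθ : θ = 4 * η * ‖A‖)
    (hD : D = 4 * ε + 28 * u * ‖A‖) {m : ℕ} {g' : Generators} (hf : ForLoop F n ε i g m g') :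
    ∀ k : ℕ, i < n → ((k + m : ℕ) : ℝ) ^ 2 * θ + n * D ≤ ‖A‖ →
      Tracked A P Q i g ((k : ℝ) ^ 2 * θ + i * D) (k * θ) ((1 + η) ^ k - 1) →
      ∃ I, n ≤ I + 1 ∧ Tracked A P Q I g' (((k + m : ℕ) : ℝ) ^ 2 * θ + n * D) ((k + m : ℕ) * θ)
        ((1 + η) ^ (k + m) - 1) := by
  have hu0 := roundoff_nonneg F
  have hη0 : 0 ≤ η := by rw [hη]; exact sub_nonneg.2 (one_le_pow₀ (by linarith))
  have hθ0 : 0 ≤ θ := by rw [hθ]; positivity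
  have hD0 : 0 ≤ D := by rw [hD]; positivity
  induction hf with
  | done i g hn =>
    intro k hi _ h
    refine ⟨i, hn, h.mono ?_⟩
    have : (i : ℝ) ≤ n := by exact_mod_cast hi.le
    gcongr
    simp
  | next i g g' g'' m m' hi hw _ ih =>
    intro k _ hk h
    have hkm : ((k + m : ℕ) : ℝ) ^ 2 * θ ≤ ((k + (m + m') : ℕ) : ℝ) ^ 2 * θ := by
      gcongr; omega
    rw [← add_assoc] at hk ⊢
    exact ih (k + m) hi hk
      (hw.tracked F hu hε hi hη hθ hD k (by rw [← add_assoc] at hkm; linarith) h)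

end Global

/-! ### The computed eigenvalues -/

section Output

variable {u : ℝ} {n : ℕ}

theorem charpoly_of_upper_eq_zero {T : Matrix (Fin n) (Fin n) ℂ} (h : ∀ a b, a < b → T a b = 0) :
    T.charpoly = ∏ j, (Polynomial.X - Polynomial.C (T j j)) := by
  rw [← charpoly_transpose, charpoly_of_isUpperTriangular]
  · rfl
  · intro a b hab
    exact h b a hab

theorem charpoly_conjTranspose_mul_mul {V : Matrix (Fin n) (Fin n) ℂ}
    (hV : V ∈ unitaryGroup (Fin n) ℂ) (T : Matrix (Fin n) (Fin n) ℂ) :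
    (Vᴴ * T * V).charpoly = T.charpoly := by
  rw [charpoly_mul_comm, ← Matrix.mul_assoc]
  have : V * Vᴴ = 1 := mem_unitaryGroup_iff.1 hV
  rw [this, Matrix.one_mul]

theorem vnorm_eq_norm_replicateCol (v : Fin n → ℂ) : vnorm v = ‖replicateCol (Fin 1) v‖ :=
  (frobenius_norm_replicateCol v).symm

theorem vecMulVec_star_eq (x y : Fin n → ℂ) :
    vecMulVec x (star y) = replicateCol (Fin 1) x * (replicateCol (Fin 1) y)ᴴ := by
  rw [vecMulVec_eq (Fin 1)]
  rfl

theorem norm_mul_mul_sub_le {x δ δ' : ℂ} (hu0 : 0 ≤ u) (hu : u ≤ 1 / 10000) (h : ‖δ‖ ≤ u)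
    (h' : ‖δ'‖ ≤ u) : ‖x * ((1 + δ) * (1 + δ')) - x‖ ≤ 3 * u * ‖x‖ := by
  have e : x * ((1 + δ) * (1 + δ')) - x = (δ + δ' + δ * δ') * x := by ring
  rw [e, norm_mul]
  gcongr
  refine norm_add₃_le.trans ?_
  rw [norm_mul]
  have : ‖δ‖ * ‖δ'‖ ≤ u * 1 := by gcongr; linarith
  linarith

/-- The computed diagonal of the final triangular matrix is the exact diagonal of a nearby one. -/
theorem exists_triangular (F : FloatArith u) (hu : u ≤ 1 / 10000) {I : ℕ} (hI : n ≤ I + 1)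
    (g : Generators) {lam : Fin n → ℂ}
    (hlam : ∀ j : Fin n, lam j = F.add (g.d j) (F.mul (g.p j) (conj (g.q j)))) :
    ∃ (B : Matrix (Fin n) (Fin n) ℂ) (p' : Matrix (Fin n) (Fin 1) ℂ),
      (B + p' * (col n g.q)ᴴ).charpoly = ∏ j, (Polynomial.X - Polynomial.C (lam j)) ∧
      ‖B - trunc n n (genMatrix I g)‖ ≤ 3 * u * ‖trunc n n (genMatrix I g)‖ ∧
      ‖p' - col n g.p‖ ≤ 3 * u * ‖col n g.p‖ := by
  have hu0 := roundoff_nonneg F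
  choose δ hδ eδ using fun j : Fin n => F.mul_err (g.p j) (conj (g.q j))
  choose δ' hδ' eδ' using fun j : Fin n => F.add_err (g.d j) (F.mul (g.p j) (conj (g.q j)))
  have hmono : ∀ {k : ℕ} {X Y : Matrix (Fin n) (Fin k) ℂ},
      (∀ a b, ‖X a b‖ ≤ 3 * u * ‖Y a b‖) → ‖X‖ ≤ 3 * u * ‖Y‖ := by
    intro k X Y h
    have : ‖((3 * u : ℝ) : ℂ) • Y‖ = 3 * u * ‖Y‖ := by
      rw [norm_smul, Complex.norm_real, Real.norm_of_nonneg (by positivity)]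
    rw [← this]
    refine frobenius_norm_mono fun a b => ?_
    rw [Matrix.smul_apply, norm_smul, Complex.norm_real, Real.norm_of_nonneg (by positivity)]
    exact h a b
  -- Here `lam a = d a (1 + δ') + p a (1 + δ)(1 + δ') conj (q a)`. The factors go into `d a` and `p
  -- a`, and `q` stays exact. The entries of `B` above the diagonal follow the new `p`, so that `B +
  -- p' q*` is exactly triangular.
  refine ⟨Matrix.of fun a b => if a = b then g.d a * (1 + δ' a) else
      if a < b then -(g.p a * ((1 + δ a) * (1 + δ' a)) * conj (g.q b)) else genMatrix I g a b,
    Matrix.of fun a _ => g.p a * ((1 + δ a) * (1 + δ' a)), ?_, hmono fun a b => ?_, hmono fun a b => ?_⟩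
  · rw [charpoly_of_upper_eq_zero]
    · refine Finset.prod_congr rfl fun j _ => ?_
      congr 2
      rw [hlam, eδ', eδ]
      simp only [Matrix.add_apply, of_apply, mul_apply, conjTranspose_apply, Finset.univ_unique,
        Finset.sum_singleton, if_true, col, trunc, RCLike.star_def]
      ring
    · intro a b hab
      simp only [Matrix.add_apply, of_apply, mul_apply, conjTranspose_apply, Finset.univ_unique,
        Finset.sum_singleton, col, trunc, RCLike.star_def, hab.ne, hab, if_true, if_false]
      ring
  · have hab3 := norm_nonneg (genMatrix I g a b)
    simp only [Matrix.sub_apply, of_apply, trunc]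
    split_ifs with h1 h2
    · subst h1
      simp only [genMatrix, if_true]
      refine (norm_mul_one_add_sub_le (hδ' a)).trans ?_
      gcongr
      linarith
    · have h3 : (a : ℕ) < b := h2
      -- As `a + 1 = b < n ≤ I + 1` excludes `I ≤ a`, no superdiagonal entry is stored separately
      -- any more.
      have h4 : ¬ ((a : ℕ) + 1 = b ∧ I ≤ a) := by have := b.2; omega
      simp only [genMatrix, upperEntry, h3.ne, h3, h4, if_true, if_false]
      have e : -(g.p a * ((1 + δ a) * (1 + δ' a)) * conj (g.q b)) =
          -(g.p a * conj (g.q b)) * ((1 + δ a) * (1 + δ' a)) := by ring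
      rw [e]
      exact norm_mul_mul_sub_le hu0 hu (hδ a) (hδ' a)
    · rw [sub_self, norm_zero]; positivity
  · exact norm_mul_mul_sub_le hu0 hu (hδ a) (hδ' a)

/-- Pulling the perturbed triangular matrix back to the original coordinates. -/
theorem Tracked.output (F : FloatArith u) (hu : u ≤ 1 / 10000) {I : ℕ} (hI : n ≤ I + 1)
    {A : Matrix (Fin n) (Fin n) ℂ} {p q : Fin n → ℂ} {g : Generators} {e s r : ℝ}
    (h : Tracked A (replicateCol (Fin 1) p) (replicateCol (Fin 1) q) I g e s r) (he : e ≤ ‖A‖)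
    {lam : Fin n → ℂ}
    (hlam : ∀ j : Fin n, lam j = F.add (g.d j) (F.mul (g.p j) (conj (g.q j)))) :
    ∃ (δA : Matrix (Fin n) (Fin n) ℂ) (δp δq : Fin n → ℂ),
      ((A + δA) + vecMulVec (p + δp) (star (q + δq))).charpoly =
        ∏ j, (Polynomial.X - Polynomial.C (lam j)) ∧
      ‖δA‖ ≤ e + 6 * u * ‖A‖ ∧ vnorm δp ≤ ((1 + 3 * u) * (1 + r) - 1) * vnorm p ∧
      vnorm δq ≤ r * vnorm q := by
  have hu0 := roundoff_nonneg F
  obtain ⟨V, hV, h1, -, h3, h4⟩ := h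
  obtain ⟨B, p', hB, hBX, hp'⟩ := exists_triangular F hu hI g hlam
  have hX := norm_le_of_near_conj hV h1 he
  have hV' := conjTranspose_mem_unitaryGroup hV
  have hVV : Vᴴ * V = 1 := mem_unitaryGroup_iff'.1 hV
  have hcancel : ∀ {k : ℕ} (X : Matrix (Fin n) (Fin k) ℂ), Vᴴ * (V * X) = X := fun X => by
    rw [← Matrix.mul_assoc, hVV, Matrix.one_mul]
  have hcol : ∀ X : Matrix (Fin n) (Fin 1) ℂ, replicateCol (Fin 1) (fun a => X a 0) = X := by
    intro X; ext a b; rw [Subsingleton.elim b 0]; rfl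
  have hpp : ‖p' - V * replicateCol (Fin 1) p‖ ≤
      ((1 + 3 * u) * (1 + r) - 1) * ‖replicateCol (Fin 1) p‖ :=
    error_chain (Z' := col n g.p) rfl (by positivity) h3 (frobenius_norm_unitary_mul hV _) hp'
      le_rfl
  have hδ : ∀ (X : Matrix (Fin n) (Fin 1) ℂ) (x : Fin n → ℂ),
      replicateCol (Fin 1) (fun a => (Vᴴ * X - replicateCol (Fin 1) x) a 0) =
        Vᴴ * (X - V * replicateCol (Fin 1) x) := by
    intro X x
    rw [hcol, Matrix.mul_sub, hcancel]
  have hsum : ∀ (X : Matrix (Fin n) (Fin 1) ℂ) (x : Fin n → ℂ),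
      replicateCol (Fin 1) (x + fun a => (Vᴴ * X - replicateCol (Fin 1) x) a 0) = Vᴴ * X := by
    intro X x
    rw [replicateCol_add, hcol, add_sub_cancel]
  refine ⟨Vᴴ * B * V - A, fun a => (Vᴴ * p' - replicateCol (Fin 1) p) a 0,
    fun a => (Vᴴ * col n g.q - replicateCol (Fin 1) q) a 0, ?_, ?_, ?_, ?_⟩
  · rw [vecMulVec_star_eq, hsum, hsum, add_sub_cancel, ← hB,
      ← charpoly_conjTranspose_mul_mul hV (B + p' * (col n g.q)ᴴ)]
    congr 1
    simp only [conjTranspose_mul, conjTranspose_conjTranspose, Matrix.mul_add, Matrix.add_mul,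
      Matrix.mul_assoc]
  · have e1 : Vᴴ * B * V - A = Vᴴ * (B - V * A * Vᴴ) * Vᴴᴴ := by
      rw [conjTranspose_conjTranspose, Matrix.mul_sub, Matrix.sub_mul]
      congr 1
      rw [Matrix.mul_assoc V, hcancel, Matrix.mul_assoc, hVV, Matrix.mul_one]
    rw [e1, frobenius_norm_conj_unitary hV']
    have t := norm_sub_le_norm_sub_add_norm_sub B (trunc n n (genMatrix I g)) (V * A * Vᴴ)
    have : u * ‖trunc n n (genMatrix I g)‖ ≤ u * (2 * ‖A‖) := by gcongr
    linarith
  · rw [vnorm_eq_norm_replicateCol, vnorm_eq_norm_replicateCol, hδ, frobenius_norm_unitary_mul hV']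
    exact hpp
  · rw [vnorm_eq_norm_replicateCol, vnorm_eq_norm_replicateCol, hδ, frobenius_norm_unitary_mul hV']
    exact h4

/-- The Hessenberg form recovers the entries above the superdiagonal from `p` and `q`, and Hermitian
symmetry gives the lower triangle. So the tracking starts with zero error. -/
theorem genMatrix_generators {A : Matrix (Fin n) (Fin n) ℂ} {p q : Fin n → ℂ} (hA : A.IsHermitian)
    (hH : IsLowerHessenberg (A + vecMulVec p (star q))) :
    trunc n n (genMatrix 0 (generators A p q)) = A := by
  have hup : ∀ a b : Fin n, (a : ℕ) < b → upperEntry 0 (generators A p q) a b = A a b := by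
    intro a b hab
    unfold upperEntry
    split_ifs with h
    · have hn : (a : ℕ) + 1 < n := by have := b.2; omega
      have : b = ⟨a + 1, hn⟩ := Fin.ext h.1.symm
      simp [generators, hn, this]
    · have := hH a b (by omega)
      rw [Matrix.add_apply, vecMulVec_apply] at this
      rw [eq_neg_of_add_eq_zero_left this]
      simp [generators]
  ext a b
  simp only [trunc, genMatrix]
  split_ifs with h1 h2
  · obtain rfl : a = b := Fin.ext h1
    simp [generators]
  · exact hup a b h2
  · rw [hup b a (by omega)]
    exact hA.apply a b

theorem pow_sub_one_le {x : ℝ} (hx : 0 ≤ x) (N : ℕ) (h : N * x ≤ 1) :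
    (1 + x) ^ N - 1 ≤ 2 * (N * x) := by
  have h0 : 0 ≤ N * x := by positivity
  have h1 : (1 + x) ^ N ≤ Real.exp (N * x) := by
    rw [Real.exp_nat_mul]
    gcongr
    linarith [Real.add_one_le_exp x]
  have h2 := Real.abs_exp_sub_one_le (x := N * x) (by rwa [abs_of_nonneg h0])
  rw [abs_of_nonneg h0] at h2
  linarith [(abs_le.1 h2).2]

end Output

end StructuredQR

end

/-! ### Choice of the constants and conclusion -/

theorem theorem4p3 :
    ∃ (C : ℝ) (a : ℕ), 0 < C ∧
      ∀ (n : ℕ) (u : ℝ) (F : FloatArith u)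
        (A : Matrix (Fin n) (Fin n) ℂ) (p q : Fin n → ℂ) (ε κ : ℝ) (m : ℕ) (lam : Fin n → ℂ),
        A.IsHermitian →
        StructuredQR.IsLowerHessenberg (A + Matrix.vecMulVec p (star q)) →
        0 < ε → 0 ≤ κ → ε ≤ κ * ‖A‖ * u →
        StructuredQR.UnshiftedQR F ε A p q m lam →
        C * (n : ℝ) ^ a * ((m : ℝ) + 1) ^ 2 * (1 + κ) * u ≤ 1 →
        ∃ (δA : Matrix (Fin n) (Fin n) ℂ) (δp δq : Fin n → ℂ),
          ((A + δA) + Matrix.vecMulVec (p + δp) (star (q + δq))).charpoly =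
            ∏ j, (Polynomial.X - Polynomial.C (lam j)) ∧
          ‖δA‖ ≤ C * (n : ℝ) ^ a * ((m : ℝ) + 1) ^ 2 * (1 + κ) * ‖A‖ * u ∧
          StructuredQR.vnorm δp ≤ C * (n : ℝ) ^ a * ((m : ℝ) + 1) * StructuredQR.vnorm p * u ∧
          StructuredQR.vnorm δq ≤ C * (n : ℝ) ^ a * ((m : ℝ) + 1) * StructuredQR.vnorm q * u := by
  open StructuredQR in
  -- The error in `A` is at most `6400 n m² u` (iterations) plus `4nκu + 28nu` (deflations) plus
  -- `6u` (output), times `‖A‖`. The exponent is 1 because an iteration uses at most `2n` rotations.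
  refine ⟨10000, 1, by norm_num, ?_⟩
  intro n u F A p q ε κ m lam hA hH hε hκ hεκ ⟨g, hloop, hlam⟩ hsmall
  rw [pow_one] at *
  have hu0 := roundoff_nonneg F
  -- From `0 < ε ≤ κ‖A‖u` it follows that `A ≠ 0`, hence `n ≥ 1`. Only then does the smallness
  -- hypothesis yield `u ≤ 1 / 10000`.
  have hA0 : 0 < ‖A‖ := by
    by_contra h
    have : ‖A‖ = 0 := le_antisymm (not_lt.1 h) (norm_nonneg _)
    rw [this] at hεκ
    simp only [mul_zero, zero_mul] at hεκ
    linarith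
  have hn : 0 < n := by
    rcases Nat.eq_zero_or_pos n with h | h
    · subst h
      rw [Subsingleton.elim A 0, norm_zero] at hA0
      exact absurd hA0 (lt_irrefl _)
    · exact h
  have hn1 : (1 : ℝ) ≤ n := by exact_mod_cast hn
  have hm0 : (0 : ℝ) ≤ m := Nat.cast_nonneg m
  set t : ℝ := n * ((m : ℝ) + 1) ^ 2 * (1 + κ) * u with ht
  have ht1 : 10000 * t ≤ 1 := by rw [ht]; linarith
  have hM1 : (1 : ℝ) ≤ ((m : ℝ) + 1) ^ 2 := one_le_pow₀ (by linarith)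
  have hmM : (m : ℝ) ≤ ((m : ℝ) + 1) ^ 2 := by nlinarith
  have hnu : (n : ℝ) * u ≤ t := by
    calc (n : ℝ) * u = n * 1 * 1 * u := by ring
      _ ≤ t := by rw [ht]; gcongr; linarith
  have hnmu : (n : ℝ) * m * u ≤ t := by
    calc (n : ℝ) * m * u = n * m * 1 * u := by ring
      _ ≤ t := by rw [ht]; gcongr; linarith
  have hnm2u : (n : ℝ) * m ^ 2 * u ≤ t := by
    calc (n : ℝ) * m ^ 2 * u = n * m ^ 2 * 1 * u := by ring
      _ ≤ t := by rw [ht]; gcongr <;> linarith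
  have hnκu : (n : ℝ) * κ * u ≤ t := by
    calc (n : ℝ) * κ * u = n * 1 * κ * u := by ring
      _ ≤ t := by rw [ht]; gcongr; linarith
  have hun : u ≤ n * u := le_mul_of_one_le_left hu0 hn1
  have hu : u ≤ 1 / 10000 := by linarith
  set η : ℝ := (1 + 400 * u) ^ (2 * n) - 1 with hη
  have hη0 : 0 ≤ η := sub_nonneg.2 (one_le_pow₀ (by linarith))
  -- The exponent times the rate is `2n · 400u`, and linearizing the power costs a further factor 2.
  have hηn : η ≤ 1600 * (n * u) := by
    have := pow_sub_one_le (x := 400 * u) (by positivity) (2 * n) (by push_cast; linarith)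
    push_cast at this
    linarith
  set r : ℝ := (1 + η) ^ m - 1 with hr
  have hmη : m * η ≤ 1600 * (n * m * u) := by
    calc m * η ≤ m * (1600 * (n * u)) := by gcongr
      _ = _ := by ring
  have hrm : r ≤ 3200 * (n * m * u) := by
    have := pow_sub_one_le hη0 m (by linarith)
    linarith
  set θ : ℝ := 4 * η * ‖A‖ with hθ
  set D : ℝ := 4 * ε + 28 * u * ‖A‖ with hD
  have hθm : (m : ℝ) ^ 2 * θ ≤ 6400 * (n * m ^ 2 * u) * ‖A‖ := by
    calc (m : ℝ) ^ 2 * θ ≤ m ^ 2 * (4 * (1600 * (n * u)) * ‖A‖) := by rw [hθ]; gcongr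
      _ = _ := by ring
  have hDn : n * D ≤ (4 * (n * κ * u) + 28 * (n * u)) * ‖A‖ := by
    calc n * D ≤ n * (4 * (κ * ‖A‖ * u) + 28 * u * ‖A‖) := by rw [hD]; gcongr
      _ = _ := by ring
  have htot : (m : ℝ) ^ 2 * θ + n * D + 6 * u * ‖A‖ ≤ 10000 * t * ‖A‖ := by
    calc _ ≤ (6400 * (n * m ^ 2 * u) + (4 * (n * κ * u) + 28 * (n * u)) + 6 * u) * ‖A‖ := by
          linarith
      _ ≤ _ := by gcongr; linarith
  have hle : 10000 * t * ‖A‖ ≤ ‖A‖ := mul_le_of_le_one_left hA0.le ht1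
  have huA : 0 ≤ 6 * u * ‖A‖ := by positivity
  have hgen := genMatrix_generators hA hH
  have hcol : ∀ x : Fin n → ℂ,
      col n (fun j => if h : j < n then x ⟨j, h⟩ else 0) = Matrix.replicateCol (Fin 1) x := by
    intro x; ext a b; simp [col, trunc]
  have hinit : Tracked A (Matrix.replicateCol (Fin 1) p) (Matrix.replicateCol (Fin 1) q) 0
      (generators A p q) (((0 : ℕ) : ℝ) ^ 2 * θ + ((0 : ℕ) : ℝ) * D) (((0 : ℕ) : ℝ) * θ)
      ((1 + η) ^ 0 - 1) := by
    refine ⟨1, one_mem _, ?_, ?_, ?_, ?_⟩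
    · rw [hgen]; simp
    · rw [hgen, hA.eq]; simp
    · simp [generators, hcol]
    · simp [generators, hcol]
  obtain ⟨I, hI, htr⟩ := hloop.tracked F hu hε.le hη hθ hD 0 hn
    (by rw [zero_add]; linarith) hinit
  rw [zero_add, ← hr] at htr
  obtain ⟨δA, δp, δq, h1, h2, h3, h4⟩ := htr.output F hu hI (by linarith) hlam
  refine ⟨δA, δp, δq, h1, ?_, ?_, ?_⟩
  · calc ‖δA‖ ≤ 10000 * t * ‖A‖ := by linarith
      _ = _ := by rw [ht]; ring
  · have hp0 : 0 ≤ vnorm p := norm_nonneg _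
    have hbound : (1 + 3 * u) * (1 + r) - 1 ≤ 10000 * (n * ((m : ℝ) + 1) * u) := by
      have : u * r ≤ 1 / 10000 * (3200 * (n * m * u)) := by
        refine mul_le_mul hu hrm (sub_nonneg.2 (one_le_pow₀ (by linarith))) (by norm_num)
      have : 0 ≤ n * m * u := by positivity
      nlinarith
    calc vnorm δp ≤ 10000 * (n * ((m : ℝ) + 1) * u) * vnorm p := h3.trans (by gcongr)
      _ = _ := by ring
  · have hq0 : 0 ≤ vnorm q := norm_nonneg _
    have hbound : r ≤ 10000 * (n * ((m : ℝ) + 1) * u) := by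
      have : 0 ≤ n * m * u := by positivity
      have : 0 ≤ n * u := by positivity
      linarith
    calc vnorm δq ≤ 10000 * (n * ((m : ℝ) + 1) * u) * vnorm q := h4.trans (by gcongr)
      _ = _ := by ring
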